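/- **Definitions.** For $n\in\mathbb N$ let $n=\{0,\dots,n-1\}$ with the usual order. Morphisms of linear orders are order embeddings; $[X]^{<\omega}$ is the set of finite subsets of $X$. For finite linear orders $a,b$ let $\mathrm{en}_a:|a|\to a$ be the increasing enumeration, and for an embedding $f:a\to b$ let $|f|:|a|\to|b|$ be the map with $\mathrm{en}_b\circ|f|=f\circ\mathrm{en}_a$. A *(coded) prae-dilator* $T$ is a functor $n\mapsto T_n$ from the category of natural numbers (with order embeddings) to countable linear orders, together with a natural transformation $\mathrm{supp}^T:T\Rightarrow[\cdot]^{<\omega}$ such that each $\sigma\in T_n$ lies in the range of $T_e$, where $e$ is the embedding into $n$ with range $\mathrm{supp}^T_n(\sigma)$. For a linear order $X$ let $$D^T_X=\{\langle a,\sigma\rangle\mid a\in[X]^{<\omega},\ \sigma\in T_{|a|},\ \mathrm{supp}^T_{|a|}(\sigma)=|a|\},$$ linearly ordered by $\langle a,\sigma\rangle<\langle b,\tau\rangle$ iff $T_{|\iota_a|}(\sigma)<T_{|\iota_b|}(\tau)$, where $\iota_a:a\hookrightarrow a\cup b$ and $\iota_b:b\hookrightarrow a\cup b$ are the inclusions.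 For an embedding $f:X\to Y$ put $D^T_f(\langle a,\sigma\rangle)=\langle f[a],\sigma\rangle$. A prae-dilator $T$ is a *dilator* if $D^T_X$ is well-founded for every countable well-order $X$; then $D^T_X$ is well-founded for every well-order $X$. A *normal prae-dilator* is a prae-dilator $T$ with a natural family of order embeddings $\mu^T_n:n\to T_n$ such that, for $m<n$ and $\sigma\in T_n$, $\sigma<\mu^T_n(m)$ holds iff every element of $\mathrm{supp}^T_n(\sigma)$ is below $m$. A *normal dilator* is a normal prae-dilator that is a dilator. Morphisms of prae-dilators are natural transformations $\nu:T\Rightarrow S$ (with order embeddings as components); a morphism of normal prae-dilators also satisfies $\nu\circ\mu^T=\mu^S$. The composition $T\circ S$ of normal prae-dilators is given by $(T\circ S)_n=D^T(S_n)$, $(T\circ S)_f=D^T(S_f)$, $\mathrm{supp}^{T\circ S}_n(\langle a,\tau\rangle)=\bigcup_{\sigma\in a}\mathrm{supp}^S_n(\sigma)$ and $\mu^{T\circ S}_n(m)=\langle\{\mu^S_n(m)\},\mu^T_1(0)\rangle$. For $\nu:S^1\Rightarrow S^2$ let $T(\nu):T\circ S^1\Rightarrow T\circ S^2$ be given by $T(\nu)_n=D^T(\nu_n)$.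 An *upper derivative* of a normal prae-dilator $T$ is a pair $(S,\xi)$ of a normal prae-dilator $S$ and a morphism $\xi:T\circ S\Rightarrow S$ of normal prae-dilators. A morphism $(S^1,\xi^1)\to(S^2,\xi^2)$ of upper derivatives is a morphism $\nu:S^1\Rightarrow S^2$ of normal prae-dilators with $\nu\circ\xi^1=\xi^2\circ T(\nu)$. A *derivative* of $T$ is an upper derivative $(S,\xi)$ such that for every upper derivative $(S',\xi')$ of $T$ there is a unique morphism $(S,\xi)\to(S',\xi')$ of upper derivatives. Let $O$ be either the set of countable ordinals (that is, $\aleph_1$) or the class of all ordinals. A function $f:O\to O$ is *normal* if it is strictly increasing and $f(\lambda)=\sup_{\alpha<\lambda}f(\alpha)$ for every limit ordinal $\lambda\in O$. The *derivative* of a normal function is the normal function that enumerates its fixed points in increasing order. **Theorem.** Let $T$ be a normal dilator and let $(S,\xi)$ be a derivative of $T$. Then $S$ is a dilator, $\alpha\mapsto\mathrm{otp}(D^T_\alpha)$ is a normal function, and $\alpha\mapsto\mathrm{otp}(D^S_\alpha)$ is the derivative of $\alpha\mapsto\mathrm{otp}(D^T_\alpha)$. This holds for these functions as functions from $\aleph_1$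 to $\aleph_1$, and also as functions on the class of all ordinals. -/

import Mathlib

open scoped Ordinal

/-- A (coded) prae-dilator: a functor `T` from the category of natural numbers (objects
`n = {0, …, n-1}`, i.e. `Fin n`; morphisms the order embeddings) to the category of countable linear
orders and order embeddings, together with a natural transformation
`supp : T ⇒ [·]^{<ω}` such that every `σ ∈ T n` lies in the range of `T (ι_σ ∘ en_σ)`, where
`ι_σ ∘ en_σ` is the unique morphism into `n` with range `supp σ`.

A countable linear order is a linear order that is isomorphic to one whose field is a set of natural
numbers; in particular every subset of `ℕ` with a linear order on it may serve as a `carrier n`. -/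
structure PraeDilator where
  carrier : ℕ → Type
  linearOrder : ∀ n, LinearOrder (carrier n)
  countable : ∀ n, Countable (carrier n)
  map : ∀ {n m : ℕ}, (Fin n ↪o Fin m) → (carrier n ↪o carrier m)
  map_id : ∀ (n : ℕ) (σ : carrier n), map (RelEmbedding.refl (· ≤ ·)) σ = σ
  map_comp : ∀ {n m k : ℕ} (f : Fin n ↪o Fin m) (g : Fin m ↪o Fin k) (σ : carrier n),
    map (f.trans g) σ = map g (map f σ)
  supp : ∀ {n : ℕ}, carrier n → Finset (Fin n)
  supp_map : ∀ {n m : ℕ} (f : Fin n ↪o Fin m) (σ : carrier n),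
    supp (map f σ) = (supp σ).map f.toEmbedding
  mem_range : ∀ {n : ℕ} (σ : carrier n),
    ∃ σ₀ : carrier (supp σ).card, map ((supp σ).orderEmbOfFin rfl) σ₀ = σ

attribute [instance] PraeDilator.linearOrder PraeDilator.countable

section FinsetMorphisms

universe u v

/-- For finite suborders `a ⊆ X`, `b ⊆ Y` and an embedding `f : X → Y` that maps `a` into `b`, this
is the unique increasing function `|f| : |a| → |b|` with `en_b ∘ |f| = f ∘ en_a`. -/
noncomputable def finsetCardMap {X : Type u} {Y : Type v} [LinearOrder X] [LinearOrder Y]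
    (f : X ↪o Y) (a : Finset X) (b : Finset Y) (h : ∀ x ∈ a, f x ∈ b) :
    Fin a.card ↪o Fin b.card :=
  OrderEmbedding.ofStrictMono
    (fun i => (b.orderIsoOfFin rfl).symm
      ⟨f (a.orderEmbOfFin rfl i), h _ (a.orderEmbOfFin_mem rfl i)⟩)
    (fun i j hij => by
      rw [OrderIso.lt_iff_lt]
      exact f.strictMono ((a.orderEmbOfFin rfl).strictMono hij))

theorem orderEmbOfFin_finsetCardMap {X : Type u} {Y : Type v} [LinearOrder X] [LinearOrder Y]
    (f : X ↪o Y) (a : Finset X) (b : Finset Y) (h : ∀ x ∈ a, f x ∈ b) (i : Fin a.card) :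
    b.orderEmbOfFin rfl (finsetCardMap f a b h i) = f (a.orderEmbOfFin rfl i) := by
  simp [finsetCardMap, ← Finset.coe_orderIsoOfFin_apply]

/-- The map `|ι_a^c| : |a| → |c|` induced by the inclusion of finite suborders `a ⊆ c` of `X`. -/
noncomputable def inclCard {X : Type u} [LinearOrder X] {a c : Finset X} (h : a ⊆ c) :
    Fin a.card ↪o Fin c.card :=
  finsetCardMap (RelEmbedding.refl (· ≤ ·)) a c h

theorem orderEmbOfFin_inclCard {X : Type u} [LinearOrder X] {a c : Finset X} (h : a ⊆ c)
    (i : Fin a.card) :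
    c.orderEmbOfFin rfl (inclCard h i) = a.orderEmbOfFin rfl i :=
  orderEmbOfFin_finsetCardMap _ _ _ _ _

theorem orderEmbOfFin_castCard {X : Type u} [LinearOrder X] {k : ℕ} (a : Finset X)
    (h : k = a.card) (i : Fin k) :
    a.orderEmbOfFin rfl (Fin.castOrderIso h i) = a.orderEmbOfFin h.symm i := by
  subst h; rfl

/-- Morphisms of natural numbers with codomain `|c|` are determined by composition with `en_c`. -/
theorem cardMap_ext {X : Type u} [LinearOrder X] {k : ℕ} {c : Finset X}
    {f g : Fin k ↪o Fin c.card}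
    (h : ∀ i, c.orderEmbOfFin rfl (f i) = c.orderEmbOfFin rfl (g i)) : f = g := by
  ext i
  exact congrArg Fin.val ((c.orderEmbOfFin rfl).injective (h i))

end FinsetMorphisms

namespace PraeDilator

universe u v w

/-- The underlying set of the order `D^T_X`: pairs `⟨a, σ⟩` of a finite set `a ⊆ X` and an element
`σ ∈ T_{|a|}` with `supp σ = |a|`. -/
structure D (T : PraeDilator) (X : Type u) [LinearOrder X] : Type u where
  dom : Finset X
  val : T.carrier dom.card
  full : T.supp val = Finset.univ

namespace D

variable {T : PraeDilator} {X : Type u} [LinearOrder X]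

/-- `T_{|ι_a^c|}(σ)` for `p = ⟨a, σ⟩` and `a ⊆ c`. -/
noncomputable def ev (p : T.D X) {c : Finset X} (h : p.dom ⊆ c) : T.carrier c.card :=
  T.map (inclCard h) p.val

theorem map_ev (p : T.D X) {c d : Finset X} (h : p.dom ⊆ c) (h' : c ⊆ d) :
    T.map (inclCard h') (p.ev h) = p.ev (h.trans h') := by
  rw [ev, ev, ← T.map_comp]
  congr 2
  apply cardMap_ext
  intro i
  simp [orderEmbOfFin_inclCard]

theorem supp_ev (p : T.D X) {c : Finset X} (h : p.dom ⊆ c) :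
    (T.supp (p.ev h)).map (c.orderEmbOfFin rfl).toEmbedding = p.dom := by
  rw [ev, T.supp_map, p.full, Finset.map_map]
  conv_rhs => rw [← Finset.map_orderEmbOfFin_univ p.dom rfl]
  congr 1
  ext i
  exact orderEmbOfFin_inclCard h i

theorem ev_injective {p q : T.D X} {c : Finset X} (hp : p.dom ⊆ c) (hq : q.dom ⊆ c)
    (h : p.ev hp = q.ev hq) : p = q := by
  have hd : p.dom = q.dom := by rw [← supp_ev p hp, ← supp_ev q hq, h]
  obtain ⟨a, σ, hσ⟩ := p
  obtain ⟨b, τ, hτ⟩ := q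
  dsimp only at hd
  subst hd
  have := (T.map (inclCard hp)).injective h
  dsimp only at this
  subst this
  rfl

/-- `⟨a, σ⟩ < ⟨b, τ⟩` if and only if `T_{|ι_a^{a ∪ b}|}(σ) < T_{|ι_b^{a ∪ b}|}(τ)`. -/
noncomputable instance : LT (T.D X) where
  lt p q := T.map (inclCard (Finset.subset_union_left (s₁ := p.dom) (s₂ := q.dom))) p.val <
    T.map (inclCard (Finset.subset_union_right (s₁ := p.dom) (s₂ := q.dom))) q.val

noncomputable instance : LE (T.D X) where
  le p q := T.map (inclCard (Finset.subset_union_left (s₁ := p.dom) (s₂ := q.dom))) p.val ≤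
    T.map (inclCard (Finset.subset_union_right (s₁ := p.dom) (s₂ := q.dom))) q.val

theorem le_iff_ev {p q : T.D X} {c : Finset X} (hp : p.dom ⊆ c) (hq : q.dom ⊆ c) :
    p ≤ q ↔ p.ev hp ≤ q.ev hq := by
  rw [← map_ev p Finset.subset_union_left (Finset.union_subset hp hq),
    ← map_ev q Finset.subset_union_right (Finset.union_subset hp hq), OrderEmbedding.le_iff_le]
  rfl

theorem lt_iff_ev {p q : T.D X} {c : Finset X} (hp : p.dom ⊆ c) (hq : q.dom ⊆ c) :
    p < q ↔ p.ev hp < q.ev hq := by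
  rw [← map_ev p Finset.subset_union_left (Finset.union_subset hp hq),
    ← map_ev q Finset.subset_union_right (Finset.union_subset hp hq), OrderEmbedding.lt_iff_lt]
  rfl

/-- The linear order on `D^T_X`. -/
noncomputable instance : LinearOrder (T.D X) where
  le_refl p := le_refl (p.ev (Finset.subset_union_left (s₂ := p.dom)))
  le_trans p q r hpq hqr := by
    have h₁ : p.dom ⊆ p.dom ∪ q.dom ∪ r.dom := by grind
    have h₂ : q.dom ⊆ p.dom ∪ q.dom ∪ r.dom := by grind
    have h₃ : r.dom ⊆ p.dom ∪ q.dom ∪ r.dom := by grind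
    rw [le_iff_ev h₁ h₂] at hpq
    rw [le_iff_ev h₂ h₃] at hqr
    rw [le_iff_ev h₁ h₃]
    exact hpq.trans hqr
  lt_iff_le_not_ge p q := by
    rw [le_iff_ev (Finset.subset_union_left (s₁ := p.dom) (s₂ := q.dom)) Finset.subset_union_right,
      le_iff_ev (Finset.subset_union_right (s₁ := p.dom) (s₂ := q.dom)) Finset.subset_union_left,
      lt_iff_ev (Finset.subset_union_left (s₁ := p.dom) (s₂ := q.dom)) Finset.subset_union_right]
    exact lt_iff_le_not_ge
  le_antisymm p q hpq hqp := by
    rw [le_iff_ev (Finset.subset_union_left (s₁ := p.dom) (s₂ := q.dom))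
      Finset.subset_union_right] at hpq
    rw [le_iff_ev (Finset.subset_union_right (s₁ := p.dom) (s₂ := q.dom))
      Finset.subset_union_left] at hqp
    exact ev_injective _ _ (le_antisymm hpq hqp)
  le_total p q := by
    rw [le_iff_ev (Finset.subset_union_left (s₁ := p.dom) (s₂ := q.dom)) Finset.subset_union_right,
      le_iff_ev (Finset.subset_union_right (s₁ := p.dom) (s₂ := q.dom)) Finset.subset_union_left]
    exact le_total _ _
  toDecidableLE := Classical.decRel _

instance [Countable X] : Countable (T.D X) := by
  let F : T.D X → Σ a : Finset X, T.carrier a.card := fun p => ⟨p.dom, p.val⟩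
  refine Function.Injective.countable (f := F) ?_
  rintro ⟨a, σ, hσ⟩ ⟨b, τ, hτ⟩ h
  simp only [F, Sigma.mk.injEq] at h
  obtain ⟨rfl, h⟩ := h
  obtain rfl := eq_of_heq h
  rfl

variable {Y : Type v} [LinearOrder Y] {Z : Type w} [LinearOrder Z]

/-- `D^T_f(⟨a, σ⟩) = ⟨[f]^{<ω}(a), σ⟩`, where `σ ∈ T_{|a|}` is viewed as an element of
`T_{|[f]^{<ω}(a)|}` along the equality `|a| = |[f]^{<ω}(a)|`. -/
noncomputable def mapFun (f : X ↪o Y) (p : T.D X) : T.D Y where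
  dom := p.dom.map f.toEmbedding
  val := T.map (Fin.castOrderIso (Finset.card_map f.toEmbedding).symm).toOrderEmbedding p.val
  full := by
    rw [T.supp_map, p.full]
    ext i
    simp only [Finset.mem_map, Finset.mem_univ, true_and, iff_true]
    exact ⟨Fin.castOrderIso (Finset.card_map f.toEmbedding) i, by ext; simp⟩

theorem orderEmbOfFin_cast_map (f : X ↪o Y) (a : Finset X) (i : Fin a.card) :
    (a.map f.toEmbedding).orderEmbOfFin rfl
      (Fin.castOrderIso (Finset.card_map f.toEmbedding).symm i) = f (a.orderEmbOfFin rfl i) := by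
  rw [orderEmbOfFin_castCard]
  have := Finset.orderEmbOfFin_unique (s := a.map f.toEmbedding) (k := a.card)
    (Finset.card_map f.toEmbedding) (f := fun i => f (a.orderEmbOfFin rfl i))
    (fun i => by simp) (f.strictMono.comp (a.orderEmbOfFin rfl).strictMono)
  exact (congrFun this i).symm

theorem ev_mapFun (f : X ↪o Y) (p : T.D X) {c : Finset X} (h : p.dom ⊆ c) :
    (p.mapFun f).ev (c := c.map f.toEmbedding) (Finset.map_subset_map.2 h) =
      T.map (Fin.castOrderIso (Finset.card_map f.toEmbedding).symm).toOrderEmbedding (p.ev h) := by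
  refine (T.map_comp _ _ p.val).symm.trans (Eq.trans ?_ (T.map_comp _ _ p.val))
  refine congrArg (fun g => T.map g p.val) (cardMap_ext fun i => ?_)
  have h₁ := orderEmbOfFin_cast_map f p.dom i
  have h₂ := orderEmbOfFin_cast_map f c (inclCard h i)
  rw [orderEmbOfFin_inclCard] at h₂
  exact (orderEmbOfFin_inclCard (Finset.map_subset_map.2 h) _).trans (h₁.trans h₂.symm)

/-- The action of `D^T` on embeddings. -/
noncomputable def map (T : PraeDilator) (f : X ↪o Y) : T.D X ↪o T.D Y :=
  OrderEmbedding.ofMapLEIff (mapFun f) (fun p q => by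
    have hp : p.dom ⊆ p.dom ∪ q.dom := Finset.subset_union_left
    have hq : q.dom ⊆ p.dom ∪ q.dom := Finset.subset_union_right
    rw [le_iff_ev hp hq, le_iff_ev (Finset.map_subset_map.2 hp) (Finset.map_subset_map.2 hq),
      ev_mapFun, ev_mapFun, OrderEmbedding.le_iff_le])

@[simp] theorem map_dom (f : X ↪o Y) (p : T.D X) :
    (D.map T f p).dom = p.dom.map f.toEmbedding := rfl

/-- Two elements of `D^T_X` agree if they arise from each other along a cast of cardinalities that
is compatible with the enumerations of their first components. -/
theorem ext_cast {p q : T.D X} (h : p.dom = q.dom) (f : Fin p.dom.card ↪o Fin q.dom.card)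
    (hq : T.map f p.val = q.val) : p = q := by
  obtain ⟨a, σ, hσ⟩ := p
  obtain ⟨b, τ, hτ⟩ := q
  dsimp only at h f hq
  subst h
  have hf : f = RelEmbedding.refl (· ≤ ·) := by
    have := Subsingleton.elim (OrderIso.ofSurjective f (Finite.surjective_of_injective
      f.injective)) (OrderIso.refl _)
    ext i
    exact congrArg Fin.val (DFunLike.congr_fun this i)
  rw [hf, T.map_id] at hq
  subst hq
  rfl

theorem map_id (p : T.D X) : D.map T (RelEmbedding.refl (· ≤ ·)) p = p := by
  symm
  refine ext_cast ?_ _ rfl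
  ext x
  simp [map_dom]

theorem map_comp (f : X ↪o Y) (g : Y ↪o Z) (p : T.D X) :
    D.map T (f.trans g) p = D.map T g (D.map T f p) := by
  symm
  have hd : (D.map T g (D.map T f p)).dom = (D.map T (f.trans g) p).dom := by
    ext x
    simp [map_dom]
  refine ext_cast hd (Fin.castOrderIso (congrArg Finset.card hd)).toOrderEmbedding ?_
  exact (congrArg _ (T.map_comp _ _ p.val).symm).trans (T.map_comp _ _ p.val).symm

/-- The range of `D^T_f` consists of the elements whose first component lies in the range of
`f`. -/
theorem exists_map_eq (f : X ↪o Y) (q : T.D Y) (h : ∀ y ∈ q.dom, ∃ x, f x = y) :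
    ∃ p : T.D X, D.map T f p = q := by
  obtain ⟨b, τ, hτ⟩ := q
  dsimp only at h
  obtain ⟨a, rfl⟩ : ∃ a : Finset X, a.map f.toEmbedding = b := by
    refine ⟨b.preimage f f.injective.injOn, ?_⟩
    ext y
    simp only [Finset.mem_map, Finset.mem_preimage]
    constructor
    · rintro ⟨x, hx, rfl⟩
      exact hx
    · intro hy
      obtain ⟨x, rfl⟩ := h y hy
      exact ⟨x, hy, rfl⟩
  let e := (Fin.castOrderIso (Finset.card_map (s := a) f.toEmbedding)).toOrderEmbedding
  refine ⟨⟨a, T.map e τ, ?_⟩, ?_⟩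
  · rw [T.supp_map, hτ]
    ext i
    simp only [Finset.mem_map, Finset.mem_univ, true_and, iff_true]
    exact ⟨Fin.castOrderIso (Finset.card_map f.toEmbedding).symm i, rfl⟩
  · refine ext_cast rfl (RelEmbedding.refl (· ≤ ·)) ?_
    refine (T.map_id _ _).trans ((T.map_comp e _ τ).symm.trans ?_)
    exact T.map_id _ τ

end D

/-- The composition `T ∘ S`, with `(T ∘ S)_n = D^T(S_n)`, `(T ∘ S)_f = D^T(S_f)` and
`supp ⟨a, τ⟩ = ⋃_{σ ∈ a} supp σ`. -/
noncomputable def comp (T S : PraeDilator) : PraeDilator where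
  carrier n := T.D (S.carrier n)
  linearOrder _ := inferInstance
  countable _ := inferInstance
  map f := D.map T (S.map f)
  map_id n p := by
    have : S.map (n := n) (RelEmbedding.refl (· ≤ ·)) = RelEmbedding.refl (· ≤ ·) := by
      ext σ
      exact S.map_id n σ
    rw [this, D.map_id]
  map_comp f g p := by
    have : S.map (f.trans g) = (S.map f).trans (S.map g) := by
      ext σ
      exact S.map_comp f g σ
    rw [this, D.map_comp]
  supp p := p.dom.biUnion fun σ => S.supp σ
  supp_map f p := by
    ext i
    simp only [D.map_dom, Finset.mem_biUnion, Finset.mem_map]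
    constructor
    · rintro ⟨_, ⟨σ, hσ, rfl⟩, hi⟩
      have hi' : i ∈ S.supp (S.map f σ) := hi
      rw [S.supp_map, Finset.mem_map] at hi'
      obtain ⟨j, hj, rfl⟩ := hi'
      exact ⟨j, ⟨σ, hσ, hj⟩, rfl⟩
    · rintro ⟨j, ⟨σ, hσ, hj⟩, rfl⟩
      refine ⟨_, ⟨σ, hσ, rfl⟩, ?_⟩
      change _ ∈ S.supp (S.map f σ)
      rw [S.supp_map]
      exact Finset.mem_map_of_mem _ hj
  mem_range {n} p := by
    apply D.exists_map_eq
    intro σ hσ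
    obtain ⟨σ₀, h₀⟩ := S.mem_range σ
    have hs : S.supp σ ⊆ p.dom.biUnion fun σ => S.supp σ :=
      Finset.subset_biUnion_of_mem (fun σ => S.supp σ) hσ
    refine ⟨S.map (inclCard hs) σ₀, ?_⟩
    rw [← S.map_comp]
    refine Eq.trans ?_ h₀
    congr 2
    ext i
    exact congrArg Fin.val (orderEmbOfFin_inclCard hs i)

/-- A morphism `ν : T ⇒ S` of prae-dilators is a natural transformation (whose components are
morphisms of linear orders). -/
structure Hom (T S : PraeDilator) where
  app : ∀ n, T.carrier n ↪o S.carrier n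
  naturality : ∀ {n m : ℕ} (f : Fin n ↪o Fin m) (σ : T.carrier n),
    app m (T.map f σ) = S.map f (app n σ)

/-- The natural transformation `T(ν) : T ∘ S¹ ⇒ T ∘ S²` with `T(ν)_n = D^T(ν_n)`. -/
noncomputable def whisker (T : PraeDilator) {S₁ S₂ : PraeDilator} (ν : Hom S₁ S₂) :
    Hom (T.comp S₁) (T.comp S₂) where
  app n := D.map T (ν.app n)
  naturality {n m} f p := by
    have : (S₁.map f).trans (ν.app m) = (ν.app n).trans (S₂.map f) := by
      ext σ
      exact ν.naturality f σ
    exact (D.map_comp (T := T) (S₁.map f) (ν.app m) p).symm.trans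
      ((congrArg (fun g => D.map T g p) this).trans (D.map_comp (ν.app n) (S₂.map f) p))

/-- A (coded) dilator is a prae-dilator `T` such that `D^T_X` is well-founded for every countable
well-order `X`. -/
def IsDilator (T : PraeDilator) : Prop :=
  ∀ (X : Type) [LinearOrder X] [Countable X] [WellFoundedLT X], WellFoundedLT (T.D X)

/-- If `T` is a dilator, then `D^T_X` is well-founded for arbitrary well-orders `X`. -/
theorem IsDilator.wellFoundedLT {T : PraeDilator} (hT : T.IsDilator) (X : Type u) [LinearOrder X]
    [WellFoundedLT X] : WellFoundedLT (T.D X) := by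
  rw [WellFoundedLT, isWellFounded_iff, RelEmbedding.wellFounded_iff_isEmpty]
  refine ⟨fun s => ?_⟩
  let Y : Set X := ⋃ n, ((s n).dom : Set X)
  have hY : Y.Countable := Set.countable_iUnion fun n => (s n).dom.countable_toSet
  have : Countable Y := hY.to_subtype
  have hsm : Small.{0} Y := inferInstance
  let W := Shrink.{0} Y
  have : Countable W := (equivShrink Y).symm.injective.countable
  let : LinearOrder W := LinearOrder.lift' (equivShrink Y).symm (equivShrink Y).symm.injective
  let f : W ↪o X := OrderEmbedding.ofMapLEIff (fun w => ((equivShrink Y).symm w : X))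
    (fun _ _ => Iff.rfl)
  have : WellFoundedLT W := ⟨(f.ltEmbedding.wellFounded wellFounded_lt)⟩
  have hr : ∀ n, ∃ p : T.D W, D.map T f p = s n := by
    intro n
    apply D.exists_map_eq
    intro y hy
    refine ⟨equivShrink Y ⟨y, Set.mem_iUnion.2 ⟨n, hy⟩⟩, ?_⟩
    simp [f]
  choose p hp using hr
  have hW := hT W
  rw [WellFoundedLT, isWellFounded_iff, RelEmbedding.wellFounded_iff_isEmpty] at hW
  refine hW.elim (RelEmbedding.natGT p fun n => ?_)
  rw [← (D.map T f).lt_iff_lt, hp, hp]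
  exact s.map_rel_iff.2 (Nat.lt_succ_self n)

/-- The function `α ↦ otp(D^T_α)` on the ordinals that is induced by a dilator `T`. -/
noncomputable def otp (T : PraeDilator) (hT : T.IsDilator) (α : Ordinal.{u}) : Ordinal.{u} :=
  haveI := hT.wellFoundedLT α.ToType
  Ordinal.type (fun p q : T.D α.ToType => p < q)

theorem otp_lt_omega_one (T : PraeDilator) (hT : T.IsDilator) {α : Ordinal.{u}} (hα : α < ω₁) :
    T.otp hT α < ω₁ := by
  have key : ∀ o : Ordinal.{u}, o < ω₁ ↔ o.card ≤ Cardinal.aleph0 := by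
    intro o
    rw [← Cardinal.ord_aleph, Cardinal.lt_ord, ← Order.lt_succ_iff, Cardinal.succ_aleph0]
  have hc : Countable α.ToType := by
    rw [← Cardinal.mk_le_aleph0_iff, Cardinal.mk_toType]
    exact (key α).1 hα
  rw [key, otp, Ordinal.card_type, Cardinal.mk_le_aleph0_iff]
  infer_instance

/-- The function `α ↦ otp(D^T_α)` on the countable ordinals, i.e. from `ℵ₁` to `ℵ₁`. -/
noncomputable def otpCountable (T : PraeDilator) (hT : T.IsDilator) :
    Set.Iio (ω₁ : Ordinal.{u}) → Set.Iio (ω₁ : Ordinal.{u}) :=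
  fun α => ⟨T.otp hT α, T.otp_lt_omega_one hT α.2⟩

end PraeDilator

/-- A normal prae-dilator: a prae-dilator `T` with a natural family of order embeddings
`μ_n : n → T_n` such that `σ < μ_n(m)` holds if and only if all elements of `supp σ` are below
`m`. -/
structure NormalPraeDilator extends PraeDilator where
  mu : ∀ n, Fin n ↪o carrier n
  mu_naturality : ∀ {n m : ℕ} (f : Fin n ↪o Fin m) (i : Fin n), mu m (f i) = map f (mu n i)
  lt_mu_iff : ∀ {n : ℕ} (σ : carrier n) (m : Fin n), σ < mu n m ↔ ∀ k ∈ supp σ, k < m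

namespace NormalPraeDilator

universe u v

theorem supp_mu (T : NormalPraeDilator) {n : ℕ} (m : Fin n) : T.supp (T.mu n m) = {m} := by
  let f : Fin 1 ↪o Fin n := OrderEmbedding.ofStrictMono (fun _ => m)
    (fun i j h => absurd h (by simp [Subsingleton.elim i j]))
  have hsub : T.supp (T.mu n m) ⊆ {m} := by
    have h : T.mu n m = T.map f (T.mu 1 0) := T.mu_naturality f 0
    rw [h, T.supp_map]
    intro k hk
    obtain ⟨i, _, rfl⟩ := Finset.mem_map.1 hk
    exact Finset.mem_singleton_self m
  refine (Finset.subset_singleton_iff.1 hsub).resolve_left fun h => ?_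
  exact lt_irrefl _ ((T.lt_mu_iff (T.mu n m) m).2 (by simp [h]))

/-- `D^{μ^T}_X(x) = ⟨{x}, μ^T_1(0)⟩`, where `1 = |{x}|`. -/
noncomputable def DmuFun (T : NormalPraeDilator) {X : Type u} [LinearOrder X] (x : X) :
    T.toPraeDilator.D X where
  dom := {x}
  val := T.mu ({x} : Finset X).card ⟨0, by simp⟩
  full := by
    rw [T.supp_mu]
    ext i
    simp only [Finset.mem_singleton, Finset.mem_univ, iff_true]
    ext
    have : (i : ℕ) < 1 := i.2.trans_eq (Finset.card_singleton x)
    change (i : ℕ) = 0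
    omega

theorem lt_DmuFun_iff (T : NormalPraeDilator) {X : Type u} [LinearOrder X]
    (p : T.toPraeDilator.D X) (x : X) : p < T.DmuFun x ↔ ∀ y ∈ p.dom, y < x := by
  have hp : p.dom ⊆ p.dom ∪ {x} := Finset.subset_union_left
  have hx : (T.DmuFun x).dom ⊆ p.dom ∪ {x} := Finset.subset_union_right
  rw [PraeDilator.D.lt_iff_ev hp hx]
  have h₁ : (T.DmuFun x).ev hx =
      T.mu _ (inclCard hx ⟨0, by simp [DmuFun]⟩) := (T.mu_naturality _ _).symm
  have h₂ : (p.dom ∪ {x}).orderEmbOfFin rfl (inclCard hx ⟨0, by simp [DmuFun]⟩) = x := by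
    rw [orderEmbOfFin_inclCard]
    exact Finset.mem_singleton.1 (Finset.orderEmbOfFin_mem ({x} : Finset X) rfl _)
  rw [h₁, T.lt_mu_iff]
  conv_rhs => rw [← PraeDilator.D.supp_ev p hp]
  simp only [Finset.mem_map, forall_exists_index, and_imp, forall_apply_eq_imp_iff₂]
  refine forall₂_congr fun k _ => ?_
  exact ((p.dom ∪ {x}).orderEmbOfFin rfl).lt_iff_lt.symm.trans (iff_of_eq (congrArg _ h₂))

/-- The order embedding `D^{μ^T}_X : X → D^T_X`. -/
noncomputable def Dmu (T : NormalPraeDilator) (X : Type u) [LinearOrder X] :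
    X ↪o T.toPraeDilator.D X :=
  OrderEmbedding.ofStrictMono T.DmuFun fun x y h =>
    (T.lt_DmuFun_iff _ _).2 fun z hz => by
      rw [Finset.mem_singleton.1 hz]
      exact h

theorem map_Dmu (T : NormalPraeDilator) {X : Type u} {Y : Type v} [LinearOrder X] [LinearOrder Y]
    (f : X ↪o Y) (x : X) :
    PraeDilator.D.map T.toPraeDilator f (T.Dmu X x) = T.Dmu Y (f x) := by
  have hd : (PraeDilator.D.map T.toPraeDilator f (T.Dmu X x)).dom = (T.Dmu Y (f x)).dom :=
    Finset.map_singleton _ _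
  refine PraeDilator.D.ext_cast hd
    (Fin.castOrderIso (congrArg Finset.card hd)).toOrderEmbedding ?_
  exact (congrArg _ (T.mu_naturality _ _).symm).trans (T.mu_naturality _ _).symm

/-- The composition `T ∘ S` of normal prae-dilators, with `μ^{T∘S}_n = D^{μ^T}_{S_n} ∘ μ^S_n`. -/
noncomputable def comp (T S : NormalPraeDilator) : NormalPraeDilator where
  toPraeDilator := T.toPraeDilator.comp S.toPraeDilator
  mu n := (S.mu n).trans (T.Dmu (S.carrier n))
  mu_naturality f i := by
    change T.Dmu _ (S.mu _ (f i)) =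
      PraeDilator.D.map T.toPraeDilator (S.map f) (T.Dmu _ (S.mu _ i))
    rw [S.mu_naturality, map_Dmu]
  lt_mu_iff {n} p m := by
    refine (T.lt_DmuFun_iff p (S.mu n m)).trans ?_
    change _ ↔ ∀ k ∈ p.dom.biUnion fun σ => S.supp σ, k < m
    simp only [S.lt_mu_iff, Finset.mem_biUnion]
    grind

/-- A morphism of normal prae-dilators is a morphism `ν : T ⇒ S` of prae-dilators with
`ν ∘ μ^T = μ^S`. -/
structure Hom (T S : NormalPraeDilator) extends
    PraeDilator.Hom T.toPraeDilator S.toPraeDilator where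
  app_mu : ∀ (n : ℕ) (i : Fin n), app n (T.mu n i) = S.mu n i

/-- An upper derivative of a normal prae-dilator `T` consists of a normal prae-dilator `S` and a
morphism `ξ : T ∘ S ⇒ S` of normal prae-dilators. -/
structure UpperDerivative (T : NormalPraeDilator) where
  S : NormalPraeDilator
  ξ : Hom (T.comp S) S

/-- A morphism `ν : S¹ ⇒ S²` of normal prae-dilators is a morphism of upper derivatives
`(S¹, ξ¹) → (S², ξ²)` of `T` if `ν ∘ ξ¹ = ξ² ∘ T(ν)`. -/
def UpperDerivative.IsMorphism {T : NormalPraeDilator} (A B : T.UpperDerivative)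
    (ν : Hom A.S B.S) : Prop :=
  ∀ (n : ℕ) (p : (T.comp A.S).carrier n),
    ν.app n (A.ξ.app n p) =
      B.ξ.app n ((T.toPraeDilator.whisker ν.toHom).app n p)

/-- An upper derivative `A = (S, ξ)` of `T` is a derivative if it is initial: for any upper
derivative `B` of `T` there is a unique morphism `A → B` of upper derivatives. -/
def UpperDerivative.IsDerivative {T : NormalPraeDilator} (A : T.UpperDerivative) : Prop :=
  ∀ B : T.UpperDerivative, ∃! ν : Hom A.S B.S, A.IsMorphism B ν

end NormalPraeDilator

/-- For a normal function `f` on a class `O` of ordinals (all ordinals, or the countable ones),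
`g` is the derivative of `f`: the normal function that enumerates the fixed points of `f` in
increasing order. -/
structure IsOrdinalDerivative {O : Type*} [LinearOrder O] (f g : O → O) : Prop where
  isNormal : Order.IsNormal g
  range_eq : Set.range g = Function.fixedPoints f

universe u

/-! Write `f α` for `otp(D^T_α)` and evaluate `D^T` on the class of all ordinals. The elements below
`T.Dmu _ α` are those whose finite domain lies below `α`, so they form a copy of `D^T_α`. Proper
initial segments are therefore small, while the ordinals embed into the whole order. Hence there is
an isomorphism `enumIso` onto the ordinals, and `f α = enumIso (T.Dmu _ α)` by `otp_eq`. Normality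
of `f` follows because domains are finite.

Every `p` satisfies `α ≤ enumIso p` for `α ∈ p.dom`, and equality forces `enumIso p` to be a fixed
point of `f`. So each ordinal is either a fixed point or is generated, in a unique way, from smaller
ordinals: the ordinals are freely generated by the fixed points `γ_α` under `enumIso`. Recursion
along this generation gives every ordinal a finite support of indices, and lets any embedding `e` of
the ordinals act by replacing `γ_α` with `γ_{e α}`. Thus `n ↦ {β | β < γ_n}` is a normal
prae-dilator, and `enumIso` restricts to the structure map of an upper derivative of `T`.

For a derivative `(S, ξ)`, initiality yields a morphism into this upper derivative, and hence an
embedding of `D^S` over the ordinals into the ordinals with `S.Dmu _ α ↦ γ_α`. This shows that `S`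
is a dilator and that `otp(D^S_α) ≤ γ_α`. Conversely, `ξ` extends to arbitrary linear orders and
makes every `otp(D^S_α)` a fixed point of `f` (`UpperDerivative.otp_otp`). A strictly increasing
function into the fixed points is bounded below by their enumeration, so `otp(D^S_α) = γ_α`. -/

namespace PraeDilator

universe v w

/-! ### `D^T_X` as a direct limit over the finite suborders of `X` -/

namespace D

section Fin

variable {T : PraeDilator} {n m : ℕ}

/-- The canonical map from `D^T_n` to `T_n`. -/
noncomputable def toCarrierFun (p : T.D (Fin n)) : T.carrier n :=
  T.map (p.dom.orderEmbOfFin rfl) p.val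

theorem toCarrierFun_eq_map_ev (p : T.D (Fin n)) {c : Finset (Fin n)} (h : p.dom ⊆ c) :
    toCarrierFun p = T.map (c.orderEmbOfFin rfl) (p.ev h) := by
  rw [ev, ← T.map_comp]
  refine congrArg (fun g => T.map g p.val) ?_
  ext i
  exact congrArg Fin.val (orderEmbOfFin_inclCard h i).symm

/-- The canonical isomorphism between `D^T_n` and `T_n`. -/
noncomputable def toCarrier (T : PraeDilator) (n : ℕ) : T.D (Fin n) ≃o T.carrier n :=
  OrderIso.ofSurjective
    (OrderEmbedding.ofMapLEIff toCarrierFun fun p q => by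
      have hp : p.dom ⊆ p.dom ∪ q.dom := Finset.subset_union_left
      have hq : q.dom ⊆ p.dom ∪ q.dom := Finset.subset_union_right
      rw [le_iff_ev hp hq, toCarrierFun_eq_map_ev p hp, toCarrierFun_eq_map_ev q hq,
        OrderEmbedding.le_iff_le])
    (fun σ => by
      obtain ⟨σ₀, h⟩ := T.mem_range σ
      refine ⟨⟨T.supp σ, σ₀, ?_⟩, h⟩
      have hs : (T.supp σ₀).map ((T.supp σ).orderEmbOfFin rfl).toEmbedding =
          Finset.univ.map ((T.supp σ).orderEmbOfFin rfl).toEmbedding := by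
        rw [← T.supp_map, h, Finset.map_orderEmbOfFin_univ]
      exact Finset.map_injective _ hs)

theorem toCarrier_map (f : Fin n ↪o Fin m) (p : T.D (Fin n)) :
    toCarrier T m (D.map T f p) = T.map f (toCarrier T n p) := by
  refine (T.map_comp _ _ p.val).symm.trans (Eq.trans ?_ (T.map_comp _ _ p.val))
  refine congrArg (fun g => T.map g p.val) ?_
  ext i
  exact congrArg Fin.val (orderEmbOfFin_cast_map f p.dom i)

end Fin

variable (T : PraeDilator) {X : Type u} [LinearOrder X] {n m : ℕ}

/-- The component `T_n → D^T_X` at `e : n → X` of the canonical cone. -/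
noncomputable def incl (e : Fin n ↪o X) : T.carrier n ↪o T.D X :=
  (toCarrier T n).symm.toOrderEmbedding.trans (D.map T e)

variable {T}

theorem incl_apply (e : Fin n ↪o X) (σ : T.carrier n) :
    incl T e σ = D.map T e ((toCarrier T n).symm σ) := rfl

theorem incl_toCarrier (e : Fin n ↪o X) (p : T.D (Fin n)) :
    incl T e (toCarrier T n p) = D.map T e p := by
  rw [incl_apply, OrderIso.symm_apply_apply]

theorem incl_map (f : Fin m ↪o Fin n) (e : Fin n ↪o X) (σ : T.carrier m) :
    incl T e (T.map f σ) = incl T (f.trans e) σ := by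
  obtain ⟨p, rfl⟩ := (toCarrier T m).surjective σ
  rw [← toCarrier_map, incl_toCarrier, incl_toCarrier, map_comp]

theorem exists_incl_eq {c : Finset X} (p : T.D X) (h : p.dom ⊆ c) :
    ∃ σ, incl T (c.orderEmbOfFin rfl) σ = p := by
  obtain ⟨q, rfl⟩ := exists_map_eq (c.orderEmbOfFin rfl) p fun y hy => by
    have : y ∈ Set.range (c.orderEmbOfFin rfl) := by
      rw [Finset.range_orderEmbOfFin]
      exact h hy
    exact this
  exact ⟨_, incl_toCarrier _ q⟩

/-- Two elements of `T_n` and `T_m` that sit above finite suborders of `X` may be compared in a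
common finite suborder. -/
theorem exists_common_extension (e : Fin n ↪o X) (e' : Fin m ↪o X) :
    ∃ (k : ℕ) (g : Fin k ↪o X) (f : Fin n ↪o Fin k) (f' : Fin m ↪o Fin k),
      f.trans g = e ∧ f'.trans g = e' := by
  let c : Finset X := Finset.univ.map e.toEmbedding ∪ Finset.univ.map e'.toEmbedding
  have key : ∀ {l : ℕ} (d : Fin l ↪o X), (∀ i, d i ∈ c) →
      ∃ f : Fin l ↪o Fin c.card, f.trans (c.orderEmbOfFin rfl) = d := by
    intro l d hd
    refine ⟨OrderEmbedding.ofMapLEIff (fun i => (c.orderIsoOfFin rfl).symm ⟨d i, hd i⟩)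
      fun i j => ?_, ?_⟩
    · rw [OrderIso.le_iff_le]
      exact d.le_iff_le
    · ext i
      simp [← Finset.coe_orderIsoOfFin_apply]
  obtain ⟨f, hf⟩ := key e fun i => by simp [c]
  obtain ⟨f', hf'⟩ := key e' fun i => by simp [c]
  exact ⟨_, _, f, f', hf, hf'⟩

/-- A linear order that is covered by a cone over the finite suborders of `X` maps into any other
such cone. -/
theorem exists_embedding_of_cones {W : Type v} {Z : Type w} [LinearOrder W] [LinearOrder Z]
    (i : ∀ {n : ℕ}, (Fin n ↪o X) → (T.carrier n ↪o W))
    (i_map : ∀ {n m : ℕ} (f : Fin m ↪o Fin n) (e : Fin n ↪o X) (σ : T.carrier m),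
      i e (T.map f σ) = i (f.trans e) σ)
    (i_surj : ∀ w, ∃ (n : ℕ) (e : Fin n ↪o X) (σ : T.carrier n), i e σ = w)
    (j : ∀ {n : ℕ}, (Fin n ↪o X) → (T.carrier n ↪o Z))
    (j_map : ∀ {n m : ℕ} (f : Fin m ↪o Fin n) (e : Fin n ↪o X) (σ : T.carrier m),
      j e (T.map f σ) = j (f.trans e) σ) :
    ∃ J : W ↪o Z, ∀ {n : ℕ} (e : Fin n ↪o X) (σ : T.carrier n), J (i e σ) = j e σ := by
  -- Both comparisons reduce to one in `T.carrier k` over a common finite suborder. Used in both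
  -- directions, this also makes `J` independent of the chosen representatives.
  have key : ∀ {n m : ℕ} (e : Fin n ↪o X) (e' : Fin m ↪o X) (σ : T.carrier n) (τ : T.carrier m),
      j e σ ≤ j e' τ ↔ i e σ ≤ i e' τ := by
    intro n m e e' σ τ
    obtain ⟨k, g, f, f', rfl, rfl⟩ := exists_common_extension e e'
    rw [← i_map, ← i_map, ← j_map, ← j_map, OrderEmbedding.le_iff_le, OrderEmbedding.le_iff_le]
  choose N E s hs using i_surj
  refine ⟨OrderEmbedding.ofMapLEIff (fun w => j (E w) (s w)) fun v w => ?_, fun e σ => ?_⟩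
  · rw [key, hs, hs]
  · change j (E (i e σ)) (s (i e σ)) = j e σ
    apply le_antisymm <;> rw [key, hs]

theorem exists_embedding_of_cone {Z : Type w} [LinearOrder Z]
    (j : ∀ {n : ℕ}, (Fin n ↪o X) → (T.carrier n ↪o Z))
    (j_map : ∀ {n m : ℕ} (f : Fin m ↪o Fin n) (e : Fin n ↪o X) (σ : T.carrier m),
      j e (T.map f σ) = j (f.trans e) σ) :
    ∃ J : T.D X ↪o Z, ∀ {n : ℕ} (e : Fin n ↪o X) (σ : T.carrier n), J (incl T e σ) = j e σ :=
  exists_embedding_of_cones (fun e => incl T e) incl_map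
    (fun p => ⟨_, _, exists_incl_eq p subset_rfl⟩) j j_map

/-! ### Transport along functions not yet known to be embeddings -/

section MapOn

variable {Y : Type v} [LinearOrder Y]

theorem exists_map_subtype_val (p : T.D X) (s : Set X) (h : ∀ x ∈ p.dom, x ∈ s) :
    ∃ q : T.D s, D.map T (OrderEmbedding.subtype (· ∈ s)) q = p :=
  exists_map_eq _ p fun y hy => ⟨⟨y, h y hy⟩, rfl⟩

/-- The restriction of a function that is strictly increasing on `s`. -/
def embOfStrictMonoOn {g : X → Y} {s : Set X} (h : StrictMonoOn g s) : s ↪o Y :=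
  OrderEmbedding.ofStrictMono (s.domRestrict g) fun x y hxy => h x.2 y.2 hxy

open Classical in
/-- The action of `D^T` on a function that is strictly increasing on the first component of the
argument. -/
noncomputable def mapOn (g : X → Y) (p : T.D X) : Option (T.D Y) :=
  if h : StrictMonoOn g p.dom then
    some (D.map T (embOfStrictMonoOn h) (exists_map_subtype_val p p.dom fun _ hx => hx).choose)
  else none

/-- Removes the choice made in `mapOn`: any presentation of the argument over which `g` becomes an
embedding computes the value, as both presentations restrict to `q.dom`. -/
theorem mapOn_eq {Z : Type w} [LinearOrder Z] (g : X → Y) (k : Z ↪o X) (l : Z ↪o Y)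
    (h : ∀ z, g (k z) = l z) (q : T.D Z) : mapOn g (D.map T k q) = some (D.map T l q) := by
  have hm : StrictMonoOn g (D.map T k q).dom := by
    intro x hx y hy hxy
    simp only [map_dom, Finset.coe_map, Set.mem_image, SetLike.mem_coe] at hx hy
    obtain ⟨x, -, rfl⟩ := hx
    obtain ⟨y, -, rfl⟩ := hy
    have : x < y := k.lt_iff_lt.1 hxy
    change g (k x) < g (k y)
    rw [h, h]
    exact l.strictMono this
  rw [mapOn, dif_pos hm]
  congr 1
  set r := (exists_map_subtype_val (D.map T k q) (D.map T k q).dom fun _ hx => hx).choose with hr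
  have hr' := (exists_map_subtype_val (D.map T k q) (D.map T k q).dom fun _ hx => hx).choose_spec
  rw [← hr] at hr'
  obtain ⟨q₀, hq₀⟩ := exists_map_subtype_val q (q.dom : Set Z) fun _ hx => hx
  let k₀ : (q.dom : Set Z) ↪o ((D.map T k q).dom : Set X) :=
    OrderEmbedding.ofMapLEIff (fun z => ⟨k z, by
      rw [map_dom, Finset.mem_coe]
      exact Finset.mem_map_of_mem k.toEmbedding z.2⟩) fun y z => k.le_iff_le
  have h₁ : D.map T k₀ q₀ = r := by
    apply (D.map T (OrderEmbedding.subtype (· ∈ ((D.map T k q).dom : Set X)))).injective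
    rw [hr', ← map_comp]
    conv_rhs => rw [← hq₀]
    rw [← map_comp]
    rfl
  rw [← h₁, ← map_comp]
  conv_rhs => rw [← hq₀, ← map_comp]
  refine congrArg (fun f => D.map T f q₀) ?_
  ext z
  exact h z

theorem mapOn_embedding (f : X ↪o Y) (p : T.D X) : mapOn f p = some (D.map T f p) := by
  have := mapOn_eq (T := T) f (RelEmbedding.refl (· ≤ ·)) f (fun _ => rfl) p
  rwa [map_id] at this

theorem mapOn_of_strictMonoOn {g : X → Y} {s : Set X} (hg : StrictMonoOn g s) (q : T.D s) :
    mapOn g (D.map T (OrderEmbedding.subtype (· ∈ s)) q) =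
      some (D.map T (embOfStrictMonoOn hg) q) :=
  mapOn_eq _ _ _ (fun _ => rfl) q

theorem mapOn_congr {g g' : X → Y} {p : T.D X} (h : ∀ x ∈ p.dom, g x = g' x) :
    mapOn g p = mapOn g' p := by
  have hs : StrictMonoOn g p.dom ↔ StrictMonoOn g' p.dom :=
    ⟨fun hm => hm.congr h, fun hm => hm.congr fun x hx => (h x hx).symm⟩
  unfold mapOn
  by_cases hm : StrictMonoOn g p.dom
  · rw [dif_pos hm, dif_pos (hs.1 hm)]
    refine congrArg (fun f => some (D.map T f _)) ?_
    ext x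
    exact h x x.2
  · rw [dif_neg hm, dif_neg (hs.not.1 hm)]

end MapOn

end D

end PraeDilator

/-! ### `D^T` over the class of ordinals, and normality -/

namespace NormalPraeDilator

universe v

open PraeDilator

section

variable (T : NormalPraeDilator) {X : Type v} [LinearOrder X]

theorem lt_Dmu_iff (p : T.toPraeDilator.D X) (x : X) : p < T.Dmu X x ↔ ∀ y ∈ p.dom, y < x :=
  T.lt_DmuFun_iff p x

theorem Dmu_le_of_mem_dom {p : T.toPraeDilator.D X} {x : X} (h : x ∈ p.dom) : T.Dmu X x ≤ p :=
  not_lt.1 fun hp => lt_irrefl x ((T.lt_Dmu_iff p x).1 hp x h)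

theorem Dmu_dom (x : X) : (T.Dmu X x).dom = {x} := rfl

theorem toCarrier_Dmu {n : ℕ} (i : Fin n) :
    D.toCarrier T.toPraeDilator n (T.Dmu (Fin n) i) = T.mu n i := by
  refine (T.mu_naturality _ _).symm.trans (congrArg (T.mu n) ?_)
  exact Finset.mem_singleton.1 (Finset.orderEmbOfFin_mem ({i} : Finset (Fin n)) rfl _)

theorem incl_mu {n : ℕ} (e : Fin n ↪o X) (i : Fin n) :
    D.incl T.toPraeDilator e (T.mu n i) = T.Dmu X (e i) := by
  rw [← toCarrier_Dmu, D.incl_toCarrier, map_Dmu]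

theorem exists_lt_Dmu (p : T.toPraeDilator.D Ordinal.{u}) : ∃ α, p < T.Dmu Ordinal.{u} α :=
  ⟨p.dom.sup id + 1, (T.lt_Dmu_iff _ _).2 fun _ hy =>
    Order.lt_add_one_iff.2 (Finset.le_sup (f := id) hy)⟩

end

variable {T : NormalPraeDilator}

/-- The inclusion of the order `α` into the class of ordinals. -/
noncomputable def toTypeEmb (α : Ordinal.{u}) : α.ToType ↪o Ordinal.{u} :=
  (Ordinal.ToType.mk (o := α)).symm.toOrderEmbedding.trans (OrderEmbedding.subtype _)

theorem toTypeEmb_lt {α : Ordinal.{u}} (x : α.ToType) : toTypeEmb α x < α :=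
  (Ordinal.ToType.mk.symm x).2

theorem exists_toTypeEmb_eq {α β : Ordinal.{u}} (h : β < α) : ∃ x, toTypeEmb α x = β :=
  ⟨Ordinal.ToType.mk ⟨β, h⟩, by simp [toTypeEmb]⟩

theorem map_toTypeEmb_lt (α : Ordinal.{u}) (p : T.toPraeDilator.D α.ToType) :
    D.map T.toPraeDilator (toTypeEmb α) p < T.Dmu Ordinal.{u} α := by
  rw [lt_Dmu_iff]
  intro y hy
  obtain ⟨x, -, rfl⟩ := Finset.mem_map.1 hy
  exact toTypeEmb_lt x

/-- With `map_toTypeEmb_lt`, this identifies `D^T_α` with the initial segment below `T.Dmu _ α`. -/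
theorem exists_map_toTypeEmb_eq {α : Ordinal.{u}} {p : T.toPraeDilator.D Ordinal.{u}}
    (h : p < T.Dmu Ordinal.{u} α) : ∃ q, D.map T.toPraeDilator (toTypeEmb α) q = p :=
  D.exists_map_eq _ _ fun y hy => exists_toTypeEmb_eq ((T.lt_Dmu_iff p α).1 h y hy)

theorem small_Iio_D (p : T.toPraeDilator.D Ordinal.{u}) : Small.{u} (Set.Iio p) := by
  obtain ⟨α, hα⟩ := T.exists_lt_Dmu p
  have hs : Set.Iio p ⊆ Set.range (D.map T.toPraeDilator (toTypeEmb α)) := fun q hq =>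
    exists_map_toTypeEmb_eq ((Set.mem_Iio.1 hq).trans hα)
  exact small_subset hs

theorem not_small_of_strictMono {Y : Type v} [LinearOrder Y] (f : Ordinal.{u} → Y)
    (hf : StrictMono f) : ¬ Small.{u} Y := fun _ =>
  not_small_ordinal.{u, u} (small_of_injective hf.injective)

/-- Of two well-orders, one is an initial segment of the other. It cannot be a proper one: proper
initial segments are small on either side, whereas neither order is small. -/
theorem nonempty_D_orderIso (hT : T.toPraeDilator.IsDilator) :
    Nonempty (T.toPraeDilator.D Ordinal.{u} ≃o Ordinal.{u}) := by
  have := hT.wellFoundedLT Ordinal.{u}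
  rcases InitialSeg.total (fun p q : T.toPraeDilator.D Ordinal.{u} => p < q)
    (fun α β : Ordinal.{u} => α < β) with f | f
  · rcases f.eq_or_principal with hs | ⟨α, hα⟩
    · exact ⟨OrderIso.ofRelIsoLT (RelIso.ofSurjective f.toRelEmbedding hs)⟩
    · have hr : Set.range f ⊆ Set.Iio α := fun β hβ => (hα β).1 hβ
      have : Small.{u} (Set.range f) := small_subset hr
      have := small_of_injective (Set.rangeFactorization_injective.2 f.injective)
      exact absurd this (not_small_of_strictMono _ (T.Dmu Ordinal.{u}).strictMono)
  · rcases f.eq_or_principal with hs | ⟨p, hp⟩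
    · exact ⟨(OrderIso.ofRelIsoLT (RelIso.ofSurjective f.toRelEmbedding hs)).symm⟩
    · have hr : Set.range f ⊆ Set.Iio p := fun β hβ => (hp β).1 hβ
      have := small_Iio_D p
      have : Small.{u} (Set.range f) := small_subset hr
      have := small_of_injective (Set.rangeFactorization_injective.2 f.injective)
      exact absurd this not_small_ordinal.{u, u}

/-- The isomorphism between `D^T` of the class of ordinals and the class of ordinals. -/
noncomputable def enumIso (hT : T.toPraeDilator.IsDilator) :
    T.toPraeDilator.D Ordinal.{u} ≃o Ordinal.{u} :=
  (nonempty_D_orderIso hT).some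

/-- A strictly increasing function on the ordinals is inflationary; apply this to `J` after the
inverse of `enumIso`. -/
theorem enumIso_le (hT : T.toPraeDilator.IsDilator)
    (J : T.toPraeDilator.D Ordinal.{u} ↪o Ordinal.{u}) (p : T.toPraeDilator.D Ordinal.{u}) :
    enumIso hT p ≤ J p := by
  have h := (J.strictMono.comp (enumIso hT).symm.strictMono).le_apply (x := enumIso hT p)
  simpa using h

theorem otp_eq (hT : T.toPraeDilator.IsDilator) (α : Ordinal.{u}) :
    T.toPraeDilator.otp hT α = enumIso hT (T.Dmu _ α) := by
  have := hT.wellFoundedLT α.ToType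
  let J : T.toPraeDilator.D α.ToType ↪o (enumIso hT (T.Dmu _ α)).ToType :=
    OrderEmbedding.ofMapLEIff (fun p => Ordinal.ToType.mk
      ⟨enumIso hT (D.map T.toPraeDilator (toTypeEmb α) p),
        Set.mem_Iio.2 ((enumIso hT).lt_iff_lt.2 (map_toTypeEmb_lt α p))⟩) fun p q => by
      rw [OrderIso.le_iff_le, Subtype.mk_le_mk, OrderIso.le_iff_le, OrderEmbedding.le_iff_le]
  have hJ : Function.Surjective J := by
    intro x
    obtain ⟨⟨β, hβ⟩, rfl⟩ := Ordinal.ToType.mk.surjective x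
    obtain ⟨p, rfl⟩ := (enumIso hT).surjective β
    obtain ⟨q, rfl⟩ := exists_map_toTypeEmb_eq ((enumIso hT).lt_iff_lt.1 hβ)
    exact ⟨q, rfl⟩
  rw [PraeDilator.otp]
  exact (RelIso.ordinalType_congr (RelIso.ofSurjective J.ltEmbedding hJ)).trans
    (Ordinal.type_toType _)

theorem isNormal_otp (hT : T.toPraeDilator.IsDilator) :
    Order.IsNormal (T.toPraeDilator.otp.{u} hT) := by
  refine Order.isNormal_iff.2 ⟨fun α β h => ?_, fun α hα β h => ?_⟩
  · rw [otp_eq, otp_eq]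
    exact (enumIso hT).strictMono ((T.Dmu _).strictMono h)
  · by_contra! hβ
    obtain ⟨p, rfl⟩ := (enumIso hT).surjective β
    rw [otp_eq, OrderIso.lt_iff_lt, lt_Dmu_iff] at hβ
    -- The domain is finite, so it stays below some ordinal smaller than the limit `α`; `p` then
    -- lies below the image of that ordinal already.
    have hlt : p.dom.sup id + 1 < α :=
      hα.add_one_lt ((Finset.sup_lt_iff (hα.bot_lt)).2 hβ)
    have := h _ hlt
    rw [otp_eq, OrderIso.le_iff_le, ← not_lt, lt_Dmu_iff] at this
    exact this fun y hy => Order.lt_add_one_iff.2 (Finset.le_sup (f := id) hy)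

theorem dom_le_enumIso (hT : T.toPraeDilator.IsDilator) {p : T.toPraeDilator.D Ordinal.{u}}
    {α : Ordinal.{u}} (h : α ∈ p.dom) : α ≤ enumIso hT p := by
  refine (isNormal_otp hT).strictMono.le_apply.trans ?_
  rw [otp_eq, OrderIso.le_iff_le]
  exact T.Dmu_le_of_mem_dom h

/-- An ordinal is a fixed point, or it is generated from smaller ordinals. -/
theorem eq_Dmu_or_dom_lt_enumIso (hT : T.toPraeDilator.IsDilator)
    (p : T.toPraeDilator.D Ordinal.{u}) :
    (T.toPraeDilator.otp hT (enumIso hT p) = enumIso hT p ∧ p = T.Dmu _ (enumIso hT p)) ∨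
      ∀ α ∈ p.dom, α < enumIso hT p := by
  rw [or_iff_not_imp_right]
  intro h
  push Not at h
  obtain ⟨α, hα, hle⟩ := h
  obtain rfl : α = enumIso hT p := (dom_le_enumIso hT hα).antisymm hle
  have h₁ : T.toPraeDilator.otp hT (enumIso hT p) = enumIso hT p := by
    refine le_antisymm ?_ (isNormal_otp hT).strictMono.le_apply
    rw [otp_eq, OrderIso.le_iff_le]
    exact T.Dmu_le_of_mem_dom hα
  refine ⟨h₁, ?_⟩
  rw [otp_eq] at h₁
  exact ((enumIso hT).injective h₁).symm

/-- A fixed point is the value of `enumIso` at its own `Dmu`, so membership below it is decided by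
the domain. -/
theorem enumIso_lt_iff (hT : T.toPraeDilator.IsDilator) {p : T.toPraeDilator.D Ordinal.{u}}
    {γ : Ordinal.{u}} (hγ : T.toPraeDilator.otp hT γ = γ) :
    enumIso hT p < γ ↔ ∀ α ∈ p.dom, α < γ := by
  rw [← lt_Dmu_iff, ← (enumIso hT).lt_iff_lt, ← otp_eq, hγ]

end NormalPraeDilator

/-! ### Generation of ordinals from fixed points -/

namespace PraeDilator.D

universe v

theorem map_congr {T : PraeDilator} {X : Type u} {Y : Type v} [LinearOrder X] [LinearOrder Y]
    {f g : X ↪o Y} {p : T.D X} (h : ∀ x ∈ p.dom, f x = g x) : D.map T f p = D.map T g p := by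
  have := mapOn_congr (T := T) h
  rw [mapOn_embedding, mapOn_embedding] at this
  exact Option.some.inj this

end PraeDilator.D

namespace NormalPraeDilator

universe v

open PraeDilator

theorem mapOn_Dmu (T : NormalPraeDilator) {X : Type u} {Y : Type v} [LinearOrder X]
    [LinearOrder Y] (g : X → Y) (x : X) :
    D.mapOn g (T.Dmu X x) = some (T.Dmu Y (g x)) := by
  let k : Fin 1 ↪o X := OrderEmbedding.ofStrictMono (fun _ => x)
    fun i j h => absurd h (by simp [Subsingleton.elim i j])
  let l : Fin 1 ↪o Y := OrderEmbedding.ofStrictMono (fun _ => g x)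
    fun i j h => absurd h (by simp [Subsingleton.elim i j])
  have := D.mapOn_eq (T := T.toPraeDilator) g k l (fun _ => rfl) (T.Dmu (Fin 1) 0)
  rwa [map_Dmu, map_Dmu] at this

variable {T : NormalPraeDilator} (hT : T.toPraeDilator.IsDilator)

/-- The enumeration of the fixed points of `α ↦ otp(D^T_α)`. -/
noncomputable def fixedPoint : Ordinal.{u} → Ordinal.{u} :=
  Ordinal.deriv (T.toPraeDilator.otp hT)

theorem fixedPoint_strictMono : StrictMono (fixedPoint.{u} hT) :=
  Ordinal.deriv_strictMono _

theorem otp_fixedPoint (α : Ordinal.{u}) :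
    T.toPraeDilator.otp hT (fixedPoint hT α) = fixedPoint hT α :=
  Ordinal.deriv_fp (isNormal_otp hT) α

theorem exists_fixedPoint_eq {α : Ordinal.{u}} (h : T.toPraeDilator.otp hT α = α) :
    ∃ β, fixedPoint hT β = α :=
  (Ordinal.mem_range_deriv (isNormal_otp hT)).2 h

theorem enumIso_Dmu_fixedPoint (α : Ordinal.{u}) :
    enumIso hT (T.Dmu _ (fixedPoint hT α)) = fixedPoint hT α := by
  rw [← otp_eq, otp_fixedPoint]

/-- Every ordinal is generated from the fixed points by means of `enumIso`. -/
theorem generation_induction {P : Ordinal.{u} → Prop} (fp : ∀ α, P (fixedPoint hT α))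
    (step : ∀ p : T.toPraeDilator.D Ordinal.{u}, (∀ α ∈ p.dom, P α) → P (enumIso hT p))
    (α : Ordinal.{u}) : P α := by
  induction α using WellFoundedLT.induction with
  | ind α ih =>
    obtain ⟨p, rfl⟩ := (enumIso hT).surjective α
    rcases eq_Dmu_or_dom_lt_enumIso hT p with ⟨h, -⟩ | h
    · obtain ⟨β, hβ⟩ := exists_fixedPoint_eq hT h
      rw [← hβ]
      exact fp β
    · exact step p fun α hα => ih α (h α hα)

section Recursion

variable {Z : Type v} [Inhabited Z] (b : Ordinal.{u} → Z)
  (s : T.toPraeDilator.D Ordinal.{u} → (Ordinal.{u} → Z) → Z)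

open Classical in
/-- Recursion along the generation of ordinals from fixed points. -/
noncomputable def genRec : Ordinal.{u} → Z :=
  WellFounded.fix (r := (· < ·)) wellFounded_lt fun α F =>
    if h : ∃ β, fixedPoint hT β = α then b h.choose
    -- Away from fixed points the domain of the preimage of `α` lies below `α`, so `default` is
    -- irrelevant once `s` looks at its second argument on that domain only.
    else s ((enumIso hT).symm α) fun β => if hβ : β < α then F β hβ else default

theorem genRec_fixedPoint (α : Ordinal.{u}) : genRec hT b s (fixedPoint hT α) = b α := by
  have h : ∃ β, fixedPoint hT β = fixedPoint hT α := ⟨α, rfl⟩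
  rw [genRec, WellFounded.fix_eq, dif_pos h, (fixedPoint_strictMono hT).injective h.choose_spec]

variable {b s}

/-- At a fixed point the recursion equation is circular, because the domain of its preimage is the
fixed point itself. The hypothesis `hmu` says that the prescribed value `b α` solves it. -/
theorem genRec_enumIso (hs : ∀ p h h', (∀ α ∈ p.dom, h α = h' α) → s p h = s p h')
    (hmu : ∀ α h, h (fixedPoint hT α) = b α → s (T.Dmu _ (fixedPoint hT α)) h = b α)
    (p : T.toPraeDilator.D Ordinal.{u}) :
    genRec hT b s (enumIso hT p) = s p (genRec hT b s) := by
  by_cases h : ∃ β, fixedPoint hT β = enumIso hT p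
  · obtain ⟨β, hβ⟩ := h
    obtain rfl : p = T.Dmu _ (fixedPoint hT β) := by
      apply (enumIso hT).injective
      rw [enumIso_Dmu_fixedPoint, hβ]
    rw [enumIso_Dmu_fixedPoint, genRec_fixedPoint, hmu]
    exact genRec_fixedPoint hT b s β
  · have hlt := (eq_Dmu_or_dom_lt_enumIso hT p).resolve_left
      fun h' => h (exists_fixedPoint_eq hT h'.1)
    rw [genRec, WellFounded.fix_eq, dif_neg h, OrderIso.symm_apply_apply]
    exact hs _ _ _ fun α hα => dif_pos (hlt α hα)

end Recursion

/-- The finite set of indices of those fixed points from which an ordinal is generated. -/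
noncomputable def genSupp : Ordinal.{u} → Finset Ordinal.{u} :=
  genRec hT (fun α => {α}) fun p h => p.dom.biUnion h

theorem genSupp_fixedPoint (α : Ordinal.{u}) : genSupp hT (fixedPoint hT α) = {α} :=
  genRec_fixedPoint hT _ _ α

theorem genSupp_enumIso (p : T.toPraeDilator.D Ordinal.{u}) :
    genSupp hT (enumIso hT p) = p.dom.biUnion (genSupp hT) := by
  refine genRec_enumIso hT (fun p h h' H => ?_) (fun α h H => ?_) p
  · exact Finset.biUnion_congr rfl H
  · rw [Dmu_dom, Finset.singleton_biUnion, H]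

/-- The segment below a fixed point contains a generated ordinal exactly when it contains its
generators. This becomes the normality condition on `μ`. -/
theorem lt_fixedPoint_iff {α β : Ordinal.{u}} :
    α < fixedPoint hT β ↔ ∀ γ ∈ genSupp hT α, γ < β := by
  induction α using generation_induction hT with
  | fp α => simp [genSupp_fixedPoint, (fixedPoint_strictMono hT).lt_iff_lt]
  | step p ih =>
    rw [enumIso_lt_iff hT (otp_fixedPoint hT β), genSupp_enumIso]
    simp only [Finset.mem_biUnion]
    grind

/-! ### Substitution of fixed points along embeddings -/

section Substitution

variable (e : Ordinal.{u} ↪o Ordinal.{u})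

/-- The function that replaces the fixed points with index `α` by those with index `e α` in the
generation of ordinals. -/
noncomputable def substFun : Ordinal.{u} → Ordinal.{u} :=
  -- `D^T` acts on embeddings only, and monotonicity is not yet available during the recursion. The
  -- junk value `0` is excluded by `substFun_strictMono`.
  genRec hT (fun α => fixedPoint hT (e α)) fun p h => (D.mapOn h p).elim 0 (enumIso hT)

theorem substFun_fixedPoint (α : Ordinal.{u}) :
    substFun hT e (fixedPoint hT α) = fixedPoint hT (e α) :=
  genRec_fixedPoint hT _ _ α

theorem substFun_enumIso (p : T.toPraeDilator.D Ordinal.{u}) :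
    substFun hT e (enumIso hT p) = (D.mapOn (substFun hT e) p).elim 0 (enumIso hT) := by
  refine genRec_enumIso hT (fun p h h' H => ?_) (fun α h H => ?_) p
  · rw [D.mapOn_congr H]
  · rw [mapOn_Dmu, H, Option.elim_some, enumIso_Dmu_fixedPoint]

theorem substFun_enumIso_of_strictMonoOn {s : Set Ordinal.{u}}
    (hs : StrictMonoOn (substFun hT e) s) (p : T.toPraeDilator.D s) :
    substFun hT e (enumIso hT (D.map T.toPraeDilator (OrderEmbedding.subtype (· ∈ s)) p)) =
      enumIso hT (D.map T.toPraeDilator (D.embOfStrictMonoOn hs) p) := by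
  rw [substFun_enumIso, D.mapOn_of_strictMonoOn hs, Option.elim_some]

theorem substFun_lt_fixedPoint {α : Ordinal.{u}}
    (hs : StrictMonoOn (substFun hT e) (Set.Iio (fixedPoint hT α))) (β : Ordinal.{u}) :
    β < fixedPoint hT α → substFun hT e β < fixedPoint hT (e α) := by
  induction β using generation_induction hT with
  | fp β =>
    rw [substFun_fixedPoint, (fixedPoint_strictMono hT).lt_iff_lt,
      (fixedPoint_strictMono hT).lt_iff_lt, e.lt_iff_lt]
    exact id
  | step p ih =>
    rw [enumIso_lt_iff hT (otp_fixedPoint hT α)]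
    intro hp
    obtain ⟨q, rfl⟩ := D.exists_map_subtype_val p (Set.Iio (fixedPoint hT α)) hp
    rw [substFun_enumIso_of_strictMonoOn hT e hs, enumIso_lt_iff hT (otp_fixedPoint hT _)]
    intro γ hγ
    obtain ⟨δ, hδ, rfl⟩ := Finset.mem_map.1 hγ
    exact ih δ (Finset.mem_map_of_mem _ hδ) δ.2

/-- Induction on the larger argument `α`. If it is a fixed point, `substFun_lt_fixedPoint` applies.
Otherwise both arguments are generated from ordinals below `α`, where the function is already
increasing, and `D^T` of an embedding preserves the order. -/
theorem substFun_strictMono : StrictMono (substFun hT e) := by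
  suffices ∀ α, ∀ β < α, substFun hT e β < substFun hT e α from fun β α h => this α β h
  intro α
  induction α using WellFoundedLT.induction with
  | ind α ih =>
    have hs : StrictMonoOn (substFun hT e) (Set.Iio α) := fun β _ γ hγ hβγ => ih γ hγ β hβγ
    obtain ⟨q, hq⟩ := (enumIso hT).surjective α
    rcases eq_Dmu_or_dom_lt_enumIso hT q with ⟨h, -⟩ | h
    · rw [hq] at h
      obtain ⟨γ, rfl⟩ := exists_fixedPoint_eq hT h
      rw [substFun_fixedPoint]
      exact substFun_lt_fixedPoint hT e hs
    · intro β hβ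
      obtain ⟨p, rfl⟩ := (enumIso hT).surjective β
      -- The weak bound by `β` suffices, so it does no harm if `β` is itself a fixed point.
      have hp : ∀ γ ∈ p.dom, γ ∈ Set.Iio α := fun γ hγ => (dom_le_enumIso hT hγ).trans_lt hβ
      rw [hq] at h
      obtain ⟨p, rfl⟩ := D.exists_map_subtype_val p (Set.Iio α) hp
      obtain ⟨q, rfl⟩ := D.exists_map_subtype_val q (Set.Iio α) h
      have hpq := hβ.trans_eq hq.symm
      rw [OrderIso.lt_iff_lt, OrderEmbedding.lt_iff_lt] at hpq
      rw [(congrArg (substFun hT e) hq).symm.trans (substFun_enumIso_of_strictMonoOn hT e hs q),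
        substFun_enumIso_of_strictMonoOn hT e hs, OrderIso.lt_iff_lt, OrderEmbedding.lt_iff_lt]
      exact hpq

/-- The embedding that replaces the fixed points with index `α` by those with index `e α` in the
generation of ordinals. -/
noncomputable def subst : Ordinal.{u} ↪o Ordinal.{u} :=
  OrderEmbedding.ofStrictMono _ (substFun_strictMono hT e)

theorem subst_fixedPoint (α : Ordinal.{u}) :
    subst hT e (fixedPoint hT α) = fixedPoint hT (e α) :=
  substFun_fixedPoint hT e α

theorem subst_enumIso (p : T.toPraeDilator.D Ordinal.{u}) :
    subst hT e (enumIso hT p) = enumIso hT (D.map T.toPraeDilator (subst hT e) p) := by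
  refine (substFun_enumIso hT e p).trans ?_
  have := D.mapOn_embedding (T := T.toPraeDilator) (subst hT e) p
  exact congrArg (fun o => Option.elim o 0 (enumIso hT)) this

theorem genSupp_subst (α : Ordinal.{u}) :
    genSupp hT (subst hT e α) = (genSupp hT α).map e.toEmbedding := by
  induction α using generation_induction hT with
  | fp α => rw [subst_fixedPoint, genSupp_fixedPoint, genSupp_fixedPoint]; rfl
  | step p ih =>
    rw [subst_enumIso, genSupp_enumIso, genSupp_enumIso]
    ext β
    simp only [D.map_dom, Finset.mem_biUnion, Finset.mem_map]
    constructor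
    · rintro ⟨_, ⟨α, hα, rfl⟩, hβ⟩
      have hβ' : β ∈ genSupp hT (subst hT e α) := hβ
      rw [ih α hα] at hβ'
      obtain ⟨γ, hγ, rfl⟩ := Finset.mem_map.1 hβ'
      exact ⟨γ, ⟨α, hα, hγ⟩, rfl⟩
    · rintro ⟨γ, ⟨α, hα, hγ⟩, rfl⟩
      refine ⟨_, ⟨α, hα, rfl⟩, ?_⟩
      change _ ∈ genSupp hT (subst hT e α)
      rw [ih α hα]
      exact Finset.mem_map_of_mem _ hγ

variable {e} in
theorem subst_congr {e' : Ordinal.{u} ↪o Ordinal.{u}} {α : Ordinal.{u}} :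
    (∀ β ∈ genSupp hT α, e β = e' β) → subst hT e α = subst hT e' α := by
  induction α using generation_induction hT with
  | fp α =>
    intro h
    rw [subst_fixedPoint, subst_fixedPoint, h α (by simp [genSupp_fixedPoint])]
  | step p ih =>
    intro h
    rw [genSupp_enumIso] at h
    rw [subst_enumIso, subst_enumIso, D.map_congr fun α hα => ih α hα fun β hβ =>
      h β (Finset.mem_biUnion.2 ⟨α, hα, hβ⟩)]

theorem subst_refl (α : Ordinal.{u}) : subst hT (RelEmbedding.refl (· ≤ ·)) α = α := by
  induction α using generation_induction hT with
  | fp α => rw [subst_fixedPoint]; rfl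
  | step p ih =>
    rw [subst_enumIso, D.map_congr (g := RelEmbedding.refl (· ≤ ·)) ih, D.map_id]

theorem subst_trans (e' : Ordinal.{u} ↪o Ordinal.{u}) (α : Ordinal.{u}) :
    subst hT (e.trans e') α = subst hT e' (subst hT e α) := by
  induction α using generation_induction hT with
  | fp α => rw [subst_fixedPoint, subst_fixedPoint, subst_fixedPoint]; rfl
  | step p ih =>
    rw [subst_enumIso, subst_enumIso, subst_enumIso,
      D.map_congr (g := (subst hT e).trans (subst hT e')) ih, D.map_comp]

variable {e} in
-- The support condition for substitution: an ordinal can be pulled back along `e` as soon as its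
-- support can, by pulling back its generators.
theorem exists_subst_eq {α : Ordinal.{u}} :
    (∀ β ∈ genSupp hT α, ∃ γ, e γ = β) → ∃ δ, subst hT e δ = α := by
  induction α using generation_induction hT with
  | fp α =>
    intro h
    obtain ⟨γ, rfl⟩ := h α (by simp [genSupp_fixedPoint])
    exact ⟨_, subst_fixedPoint hT e γ⟩
  | step p ih =>
    intro h
    rw [genSupp_enumIso] at h
    obtain ⟨q, rfl⟩ := D.exists_map_eq (subst hT e) p fun α hα => ih α hα fun β hβ =>
      h β (Finset.mem_biUnion.2 ⟨α, hα, hβ⟩)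
    exact ⟨_, subst_enumIso hT e q⟩

end Substitution

end NormalPraeDilator

/-! ### The upper derivative formed by the ordinals below the fixed points -/

namespace NormalPraeDilator

universe v

open PraeDilator

/-- The inclusion of a natural number into the class of ordinals. -/
noncomputable def natEmb (n : ℕ) : Fin n ↪o Ordinal.{u} :=
  OrderEmbedding.ofMapLEIff (fun k => ((k : ℕ) : Ordinal.{u})) fun k l => by
    rw [Nat.cast_le, Fin.val_fin_le]

theorem natEmb_lt {n : ℕ} (k : Fin n) : natEmb.{u} n k < n :=
  Nat.cast_lt.2 k.2

theorem exists_natEmb_eq {n : ℕ} {α : Ordinal.{u}} (h : α < n) : ∃ k, natEmb n k = α := by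
  obtain ⟨m, rfl⟩ := Ordinal.lt_omega0.1 (h.trans (Ordinal.natCast_lt_omega0 n))
  exact ⟨⟨m, Nat.cast_lt.1 h⟩, rfl⟩

/-- Substitution is defined for self-embeddings of the ordinals, but functoriality concerns
embeddings of `n`. By `subst_congr`, the choice of extension does not affect ordinals with support
below `n`. -/
theorem exists_extension {n : ℕ} (e : Fin n ↪o Ordinal.{u}) :
    ∃ g : Ordinal.{u} ↪o Ordinal.{u}, ∀ k, g (natEmb n k) = e k := by
  classical
  let g : Ordinal.{u} → Ordinal.{u} := fun α =>
    -- The summand `Finset.univ.sup e + 1` pushes all remaining values above the range of `e`.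
    if h : ∃ k, natEmb n k = α then e h.choose else Finset.univ.sup e + 1 + α
  have hg : ∀ k, g (natEmb n k) = e k := fun k => by
    have h : ∃ l, natEmb.{u} n l = natEmb n k := ⟨k, rfl⟩
    rw [show g (natEmb n k) = e h.choose from dif_pos h, (natEmb n).injective h.choose_spec]
  have hg' : ∀ α : Ordinal.{u}, ¬ α < n → g α = Finset.univ.sup e + 1 + α := fun α hα =>
    dif_neg fun ⟨k, hk⟩ => hα (hk.symm.trans_lt (natEmb_lt k))
  refine ⟨OrderEmbedding.ofStrictMono g fun α β h => ?_, hg⟩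
  by_cases hβ : β < n
  · obtain ⟨k, rfl⟩ := exists_natEmb_eq hβ
    obtain ⟨l, rfl⟩ := exists_natEmb_eq (h.trans hβ)
    rw [hg, hg]
    exact e.strictMono ((natEmb n).lt_iff_lt.1 h)
  · rw [hg' β hβ]
    by_cases hα : α < n
    · obtain ⟨k, rfl⟩ := exists_natEmb_eq hα
      rw [hg]
      exact (Order.lt_add_one_iff.2 (Finset.le_sup (Finset.mem_univ k))).trans_le le_self_add
    · rw [hg' α hα]
      exact (add_lt_add_iff_left _).2 h

/-- An extension of an embedding of a natural number to the class of ordinals. -/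
noncomputable def extend {n : ℕ} (e : Fin n ↪o Ordinal.{u}) : Ordinal.{u} ↪o Ordinal.{u} :=
  (exists_extension e).choose

theorem extend_natEmb {n : ℕ} (e : Fin n ↪o Ordinal.{u}) (k : Fin n) :
    extend e (natEmb n k) = e k :=
  (exists_extension e).choose_spec k

theorem lt_omega_one_iff_card {α : Ordinal.{u}} : α < ω₁ ↔ α.card ≤ Cardinal.aleph0 := by
  rw [← Cardinal.ord_aleph, Cardinal.lt_ord, ← Order.lt_succ_iff, Cardinal.succ_aleph0]

theorem isSuccLimit_omega_one : Order.IsSuccLimit (ω₁ : Ordinal.{u}) := by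
  rw [← Cardinal.ord_aleph]
  exact Cardinal.isSuccLimit_ord (Cardinal.aleph0_le_aleph 1)

variable {T : NormalPraeDilator} (hT : T.toPraeDilator.IsDilator)

theorem nfp_otp_lt_omega_one {α : Ordinal.{u}} (h : α < ω₁) :
    Ordinal.nfp (T.toPraeDilator.otp hT) α < ω₁ := by
  rw [← Ordinal.iSup_iterate_eq_nfp]
  refine Ordinal.iSup_lt_omega_one fun n => ?_
  induction n with
  | zero => exact h
  | succ n ih =>
    rw [Function.iterate_succ_apply']
    exact T.toPraeDilator.otp_lt_omega_one hT ih

/-- Needed for countable carriers. Each next fixed point is a countable supremum of iterates of `f`,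
which preserves countability. -/
theorem fixedPoint_natCast_lt_omega_one (n : ℕ) : fixedPoint.{u} hT n < ω₁ := by
  induction n with
  | zero =>
    rw [Nat.cast_zero, fixedPoint, Ordinal.deriv_zero_right]
    exact nfp_otp_lt_omega_one hT isSuccLimit_omega_one.bot_lt
  | succ n ih =>
    rw [Nat.cast_succ, fixedPoint, Ordinal.deriv_add_one]
    exact nfp_otp_lt_omega_one hT (isSuccLimit_omega_one.add_one_lt ih)

instance (n : ℕ) : Countable (Set.Iio (fixedPoint.{u} hT n)) := by
  rw [← Cardinal.mk_le_aleph0_iff, Cardinal.mk_Iio_ordinal, Cardinal.lift_le_aleph0]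
  exact lt_omega_one_iff_card.1 (fixedPoint_natCast_lt_omega_one hT n)

/-- A small copy of the set of ordinals below the fixed point with index `n`. -/
def FixedPointCarrier (n : ℕ) : Type := Shrink.{0} (Set.Iio (fixedPoint.{u} hT n))

namespace FixedPointCarrier

noncomputable instance (n : ℕ) : LinearOrder (FixedPointCarrier.{u} hT n) :=
  inferInstanceAs (LinearOrder (Shrink.{0} (Set.Iio (fixedPoint.{u} hT n))))

instance (n : ℕ) : Countable (FixedPointCarrier.{u} hT n) :=
  (equivShrink.{0} (Set.Iio (fixedPoint.{u} hT n))).symm.injective.countable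

/-- The inclusion into the class of ordinals. -/
noncomputable def val (n : ℕ) : FixedPointCarrier.{u} hT n ↪o Ordinal.{u} :=
  (orderIsoShrink.{0} (Set.Iio (fixedPoint.{u} hT n))).symm.toOrderEmbedding.trans
    (OrderEmbedding.subtype _)

theorem val_lt {n : ℕ} (σ : FixedPointCarrier.{u} hT n) : val hT n σ < fixedPoint hT n :=
  ((equivShrink.{0} (Set.Iio (fixedPoint.{u} hT n))).symm σ).2

theorem exists_val_eq {n : ℕ} {α : Ordinal.{u}} (h : α < fixedPoint hT n) :
    ∃ σ, val hT n σ = α :=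
  ⟨equivShrink.{0} _ ⟨α, h⟩, congrArg Subtype.val (Equiv.symm_apply_apply _ _)⟩

variable {hT} {X : Type v} [LinearOrder X]

/-- The codomain restriction of an embedding whose values are below the fixed point with
index `n`. -/
noncomputable def lift {n : ℕ} (K : X ↪o Ordinal.{u}) (h : ∀ x, K x < fixedPoint hT n) :
    X ↪o FixedPointCarrier.{u} hT n :=
  OrderEmbedding.ofMapLEIff (fun x => (exists_val_eq hT (h x)).choose) fun x y => by
    rw [← (val hT n).le_iff_le, (exists_val_eq hT (h x)).choose_spec,
      (exists_val_eq hT (h y)).choose_spec, K.le_iff_le]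

theorem val_lift {n : ℕ} (K : X ↪o Ordinal.{u}) (h : ∀ x, K x < fixedPoint hT n) (x : X) :
    val hT n (lift K h x) = K x :=
  (exists_val_eq hT (h x)).choose_spec

open Classical in
/-- The support, as a set of natural numbers. -/
noncomputable def supp {n : ℕ} (σ : FixedPointCarrier.{u} hT n) : Finset (Fin n) :=
  Finset.univ.filter fun k => natEmb n k ∈ genSupp hT (val hT n σ)

theorem mem_supp {n : ℕ} {σ : FixedPointCarrier.{u} hT n} {k : Fin n} :
    k ∈ supp σ ↔ natEmb n k ∈ genSupp hT (val hT n σ) := by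
  simp [supp]

theorem exists_mem_supp {n : ℕ} {σ : FixedPointCarrier.{u} hT n} {α : Ordinal.{u}}
    (h : α ∈ genSupp hT (val hT n σ)) : ∃ k ∈ supp σ, natEmb n k = α := by
  obtain ⟨k, rfl⟩ := exists_natEmb_eq ((lt_fixedPoint_iff hT).1 (val_lt hT σ) α h)
  exact ⟨k, mem_supp.2 h, rfl⟩

variable (hT) in
/-- The inclusion along an embedding of `n` into the class of ordinals. -/
noncomputable def toOrdinal {n : ℕ} (e : Fin n ↪o Ordinal.{u}) :
    FixedPointCarrier.{u} hT n ↪o Ordinal.{u} :=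
  (val hT n).trans (subst hT (extend e))

theorem mem_genSupp_toOrdinal {n : ℕ} {e : Fin n ↪o Ordinal.{u}} {σ : FixedPointCarrier.{u} hT n}
    {α : Ordinal.{u}} : α ∈ genSupp hT (toOrdinal hT e σ) ↔ ∃ k ∈ supp σ, e k = α := by
  change α ∈ genSupp hT (subst hT (extend e) (val hT n σ)) ↔ _
  rw [genSupp_subst, Finset.mem_map]
  constructor
  · rintro ⟨β, hβ, rfl⟩
    obtain ⟨k, hk, rfl⟩ := exists_mem_supp hβ
    exact ⟨k, hk, (extend_natEmb e k).symm⟩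
  · rintro ⟨k, hk, rfl⟩
    exact ⟨_, mem_supp.1 hk, extend_natEmb e k⟩

theorem toOrdinal_lt {n : ℕ} {e : Fin n ↪o Ordinal.{u}} {α : Ordinal.{u}} (h : ∀ k, e k < α)
    (σ : FixedPointCarrier.{u} hT n) : toOrdinal hT e σ < fixedPoint hT α := by
  rw [lt_fixedPoint_iff]
  intro β hβ
  obtain ⟨k, -, rfl⟩ := mem_genSupp_toOrdinal.1 hβ
  exact h k

/-- The action of morphisms between natural numbers. -/
noncomputable def map {n m : ℕ} (f : Fin n ↪o Fin m) :
    FixedPointCarrier.{u} hT n ↪o FixedPointCarrier.{u} hT m :=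
  lift (toOrdinal hT (f.trans (natEmb m))) (toOrdinal_lt fun k => natEmb_lt (f k))

theorem val_map {n m : ℕ} (f : Fin n ↪o Fin m) (σ : FixedPointCarrier.{u} hT n) :
    val hT m (map f σ) = toOrdinal hT (f.trans (natEmb m)) σ :=
  val_lift _ _ σ

theorem toOrdinal_natEmb {n : ℕ} (σ : FixedPointCarrier.{u} hT n) :
    toOrdinal hT (natEmb n) σ = val hT n σ := by
  refine Eq.trans ?_ (subst_refl hT _)
  refine subst_congr hT fun α hα => ?_
  obtain ⟨k, -, rfl⟩ := exists_mem_supp hα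
  exact extend_natEmb _ k

/-- The two extensions composed and the single extension agree on the support of `σ`. This is the
cone condition behind functoriality and behind the embedding `J` below. -/
theorem toOrdinal_map {n m : ℕ} (f : Fin n ↪o Fin m) (e : Fin m ↪o Ordinal.{u})
    (σ : FixedPointCarrier.{u} hT n) : toOrdinal hT e (map f σ) = toOrdinal hT (f.trans e) σ := by
  change subst hT (extend e) (val hT m (map f σ)) = _
  rw [val_map]
  refine (subst_trans hT _ _ _).symm.trans (subst_congr hT fun α hα => ?_)
  obtain ⟨k, -, rfl⟩ := exists_mem_supp hα
  rw [extend_natEmb]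
  change extend e (extend _ (natEmb n k)) = _
  rw [extend_natEmb]
  exact extend_natEmb e (f k)

theorem toOrdinal_enumIso {n : ℕ} (e : Fin n ↪o Ordinal.{u}) {σ : FixedPointCarrier.{u} hT n}
    {p : T.toPraeDilator.D (FixedPointCarrier.{u} hT n)}
    (h : val hT n σ = enumIso hT (D.map T.toPraeDilator (val hT n) p)) :
    toOrdinal hT e σ = enumIso hT (D.map T.toPraeDilator (toOrdinal hT e) p) := by
  change subst hT (extend e) (val hT n σ) = _
  rw [h, subst_enumIso, ← D.map_comp]
  rfl

theorem map_id (n : ℕ) (σ : FixedPointCarrier.{u} hT n) :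
    map (RelEmbedding.refl (· ≤ ·)) σ = σ := by
  apply (val hT n).injective
  rw [val_map]
  exact toOrdinal_natEmb σ

theorem map_comp {n m k : ℕ} (f : Fin n ↪o Fin m) (g : Fin m ↪o Fin k)
    (σ : FixedPointCarrier.{u} hT n) : map (f.trans g) σ = map g (map f σ) := by
  apply (val hT k).injective
  rw [val_map, val_map, toOrdinal_map]
  rfl

theorem supp_map {n m : ℕ} (f : Fin n ↪o Fin m) (σ : FixedPointCarrier.{u} hT n) :
    supp (map f σ) = (supp σ).map f.toEmbedding := by
  ext k
  rw [mem_supp, val_map, mem_genSupp_toOrdinal, Finset.mem_map]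
  exact exists_congr fun l => and_congr_right fun _ => (natEmb m).injective.eq_iff

theorem mem_range {n : ℕ} (σ : FixedPointCarrier.{u} hT n) :
    ∃ σ₀ : FixedPointCarrier.{u} hT (supp σ).card, map ((supp σ).orderEmbOfFin rfl) σ₀ = σ := by
  let e := ((supp σ).orderEmbOfFin rfl).trans (natEmb.{u} n)
  have he : ∀ α ∈ genSupp hT (val hT n σ), ∃ k, e k = α := by
    intro α hα
    obtain ⟨k, hk, rfl⟩ := exists_mem_supp hα
    have : k ∈ Set.range ((supp σ).orderEmbOfFin rfl) := by
      rw [Finset.range_orderEmbOfFin]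
      exact hk
    obtain ⟨l, rfl⟩ := this
    exact ⟨l, rfl⟩
  obtain ⟨δ, hδ⟩ := exists_subst_eq hT (e := extend e) (α := val hT n σ) fun α hα => by
    obtain ⟨k, rfl⟩ := he α hα
    exact ⟨_, extend_natEmb e k⟩
  -- An index `β` in the support of `δ` is sent by `extend e` to some `e k`, as is `natEmb _ k`;
  -- injectivity makes `β` a natural number below the cardinality of the support.
  have hlt : δ < fixedPoint hT (supp σ).card := by
    rw [lt_fixedPoint_iff]
    intro β hβ
    have hβ' : extend e β ∈ genSupp hT (val hT n σ) := by
      rw [← hδ, genSupp_subst]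
      exact Finset.mem_map_of_mem _ hβ
    obtain ⟨k, hk⟩ := he _ hβ'
    rw [← extend_natEmb, (extend e).injective.eq_iff] at hk
    exact hk ▸ natEmb_lt k
  obtain ⟨σ₀, rfl⟩ := exists_val_eq hT hlt
  refine ⟨σ₀, (val hT n).injective ?_⟩
  rw [val_map]
  exact hδ

/-- The embedding of generators. -/
noncomputable def mu (n : ℕ) : Fin n ↪o FixedPointCarrier.{u} hT n :=
  lift ((natEmb n).trans (OrderEmbedding.ofStrictMono _ (fixedPoint_strictMono hT)))
    fun k => fixedPoint_strictMono hT (natEmb_lt k)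

theorem val_mu {n : ℕ} (k : Fin n) :
    val hT n (mu n k) = fixedPoint.{u} hT (natEmb n k) :=
  val_lift _ _ k

theorem toOrdinal_mu {n : ℕ} (e : Fin n ↪o Ordinal.{u}) (k : Fin n) :
    toOrdinal hT e (mu n k) = fixedPoint hT (e k) := by
  change subst hT (extend e) (val hT n (mu n k)) = _
  rw [val_mu, subst_fixedPoint, extend_natEmb]

theorem lt_mu_iff {n : ℕ} (σ : FixedPointCarrier.{u} hT n) (m : Fin n) :
    σ < mu n m ↔ ∀ k ∈ supp σ, k < m := by
  rw [← (val hT n).lt_iff_lt, val_mu, lt_fixedPoint_iff]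
  constructor
  · intro h k hk
    exact (natEmb n).lt_iff_lt.1 (h _ (mem_supp.1 hk))
  · intro h α hα
    obtain ⟨k, hk, rfl⟩ := exists_mem_supp hα
    exact (natEmb n).lt_iff_lt.2 (h k hk)

end FixedPointCarrier

open FixedPointCarrier

/-- The normal prae-dilator that is given by the ordinals below the fixed points. -/
noncomputable def fixedPointDilator : NormalPraeDilator where
  carrier n := FixedPointCarrier.{u} hT n
  linearOrder _ := inferInstance
  countable _ := inferInstance
  map f := FixedPointCarrier.map f
  map_id := FixedPointCarrier.map_id
  map_comp := FixedPointCarrier.map_comp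
  supp σ := FixedPointCarrier.supp σ
  supp_map := FixedPointCarrier.supp_map
  mem_range := FixedPointCarrier.mem_range
  mu n := FixedPointCarrier.mu n
  mu_naturality {n m} f i := by
    apply (val hT m).injective
    rw [val_map, toOrdinal_mu, val_mu]
    rfl
  lt_mu_iff := FixedPointCarrier.lt_mu_iff

/-- The map from `D^T_X` to `X` for the set `X` of ordinals below a fixed point. -/
noncomputable def fixedPointXi (n : ℕ) :
    T.toPraeDilator.D (FixedPointCarrier.{u} hT n) ↪o FixedPointCarrier.{u} hT n :=
  lift ((D.map T.toPraeDilator (val hT n)).trans (enumIso hT).toOrderEmbedding) fun p => by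
    change enumIso hT (D.map T.toPraeDilator (val hT n) p) < _
    rw [enumIso_lt_iff hT (otp_fixedPoint hT _)]
    intro α hα
    obtain ⟨σ, -, rfl⟩ := Finset.mem_map.1 hα
    exact val_lt hT σ

theorem val_fixedPointXi {n : ℕ} (p : T.toPraeDilator.D (FixedPointCarrier.{u} hT n)) :
    val hT n (fixedPointXi hT n p) = enumIso hT (D.map T.toPraeDilator (val hT n) p) :=
  val_lift _ _ p

/-- The upper derivative that is given by the ordinals below the fixed points. -/
noncomputable def fixedPointUpperDerivative : T.UpperDerivative where
  S := fixedPointDilator.{u} hT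
  ξ :=
    { app := fixedPointXi hT
      naturality := fun {n m} f p => by
        apply (val hT m).injective
        change val hT m (fixedPointXi hT m (D.map T.toPraeDilator (FixedPointCarrier.map f) p)) =
          val hT m (FixedPointCarrier.map f (fixedPointXi hT n p))
        rw [val_map, toOrdinal_enumIso _ (val_fixedPointXi hT p), val_fixedPointXi]
        refine congrArg (enumIso hT) ((D.map_comp (T := T.toPraeDilator) _ _ p).symm.trans
          (D.map_congr fun σ _ => ?_))
        exact val_map f σ
      app_mu := fun n i => by
        apply (val hT n).injective
        change val hT n (fixedPointXi hT n (T.Dmu _ (FixedPointCarrier.mu n i))) =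
          val hT n (FixedPointCarrier.mu n i)
        rw [val_fixedPointXi, map_Dmu, val_mu, enumIso_Dmu_fixedPoint] }

/-! ### Comparison of a derivative with the fixed points -/

variable {hT} in
/-- A morphism into the upper derivative of fixed points yields a bound. -/
theorem exists_embedding_of_hom {S : NormalPraeDilator}
    (ν : Hom S (fixedPointDilator.{u} hT)) :
    ∃ J : S.toPraeDilator.D Ordinal.{u} ↪o Ordinal.{u},
      ∀ α, J (S.Dmu _ α) = fixedPoint hT α := by
  obtain ⟨J, hJ⟩ := D.exists_embedding_of_cone (T := S.toPraeDilator) (X := Ordinal.{u})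
    (fun {n} e => (ν.app n).trans (toOrdinal hT e)) fun {n m} f e σ => by
      change toOrdinal hT e (ν.app n (S.map f σ)) = toOrdinal hT (f.trans e) (ν.app m σ)
      rw [ν.naturality]
      exact toOrdinal_map f e _
  refine ⟨J, fun α => ?_⟩
  -- The element `S.Dmu _ α` comes from `S.mu 1 0` along the embedding that picks out `α`, so `J` is
  -- computed at stage `1`.
  let e : Fin 1 ↪o Ordinal.{u} := OrderEmbedding.ofStrictMono (fun _ => α)
    fun i j h => absurd h (by simp [Subsingleton.elim i j])
  have h := hJ e (S.mu 1 0)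
  rw [incl_mu] at h
  refine h.trans ?_
  change toOrdinal hT e (ν.app 1 (S.mu 1 0)) = _
  rw [ν.app_mu]
  exact toOrdinal_mu e 0

/-- A well-order embeds into the ordinals by order types of initial segments, so its image under
`D^S` embeds into the ordinals as well. -/
theorem isDilator_of_embedding {S : PraeDilator} (J : S.D Ordinal.{u} ↪o Ordinal.{u}) :
    S.IsDilator := by
  intro X _ _ hX
  have : WellFoundedLT X := hX
  let k : X ↪o Ordinal.{u} := OrderEmbedding.ofMapLEIff
    (fun x => Ordinal.lift.{u} (Ordinal.typein (fun y z : X => y < z) x)) fun x y => by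
      rw [Ordinal.lift_le, Ordinal.typein_le_typein, not_lt]
  exact (J.strictMono.comp (D.map S k).strictMono).wellFoundedLT

/-- Extends `ξ` from natural numbers to arbitrary `X`. An element of `D^T` over `D^S_X` involves
finitely many elements of `D^S_X`, each with finite domain, so the stages `(T ∘ S)_n` cover
everything. The second clause is compatibility of `ξ` with `μ`. -/
theorem UpperDerivative.exists_embedding (A : T.UpperDerivative) (X : Type v) [LinearOrder X] :
    ∃ K : T.toPraeDilator.D (A.S.toPraeDilator.D X) ↪o A.S.toPraeDilator.D X,
      ∀ x, K (T.Dmu _ (A.S.Dmu X x)) = A.S.Dmu X x := by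
  obtain ⟨K, hK⟩ := D.exists_embedding_of_cones (T := (T.comp A.S).toPraeDilator) (X := X)
    (W := T.toPraeDilator.D (A.S.toPraeDilator.D X)) (Z := A.S.toPraeDilator.D X)
    (fun e => D.map T.toPraeDilator (D.incl A.S.toPraeDilator e))
    (fun {n m} f e p => by
      refine (D.map_comp (T := T.toPraeDilator) (A.S.map f) _ p).symm.trans ?_
      exact D.map_congr fun σ _ => D.incl_map f e σ)
    (fun p => by
      let c : Finset X := p.dom.biUnion fun q => q.dom
      refine ⟨c.card, c.orderEmbOfFin rfl, D.exists_map_eq _ p fun q hq => ?_⟩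
      exact D.exists_incl_eq q (Finset.subset_biUnion_of_mem (fun q => q.dom) hq))
    (fun {n} e => (A.ξ.app n).trans (D.incl A.S.toPraeDilator e))
    (fun {n m} f e p => by
      change D.incl A.S.toPraeDilator e (A.ξ.app n ((T.comp A.S).map f p)) =
        D.incl A.S.toPraeDilator (f.trans e) (A.ξ.app m p)
      rw [A.ξ.naturality]
      exact D.incl_map f e _)
  refine ⟨K, fun x => ?_⟩
  let e : Fin 1 ↪o X := OrderEmbedding.ofStrictMono (fun _ => x)
    fun i j h => absurd h (by simp [Subsingleton.elim i j])
  have h := hK e ((T.comp A.S).mu 1 0)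
  have h₁ : D.map T.toPraeDilator (D.incl A.S.toPraeDilator e) ((T.comp A.S).mu 1 0) =
      T.Dmu _ (A.S.Dmu X x) :=
    (map_Dmu T (D.incl A.S.toPraeDilator e) (A.S.mu 1 0)).trans
      (congrArg (T.Dmu _) (incl_mu A.S e 0))
  refine (congrArg K h₁).symm.trans (h.trans ?_)
  change D.incl A.S.toPraeDilator e (A.ξ.app 1 ((T.comp A.S).mu 1 0)) = _
  rw [A.ξ.app_mu]
  exact incl_mu A.S e 0

/-- Conjugating the extension of `ξ` with `D^S ≅` ordinals gives an embedding of `D^T` over the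
ordinals into the ordinals that sends `T.Dmu _ δ` to `δ` for `δ = otp(D^S_α)`. Minimality of
`enumIso` then bounds `f δ` by `δ`. -/
theorem UpperDerivative.otp_otp (A : T.UpperDerivative) (hS : A.S.toPraeDilator.IsDilator)
    (α : Ordinal.{u}) :
    T.toPraeDilator.otp hT (A.S.toPraeDilator.otp hS α) = A.S.toPraeDilator.otp hS α := by
  refine le_antisymm ?_ (isNormal_otp hT).strictMono.le_apply
  obtain ⟨K, hK⟩ := A.exists_embedding Ordinal.{u}
  let I := enumIso hS
  have h := enumIso_le hT (((D.map T.toPraeDilator I.symm.toOrderEmbedding).trans K).trans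
    I.toOrderEmbedding) (T.Dmu _ (A.S.toPraeDilator.otp hS α))
  rw [← otp_eq] at h
  refine h.trans_eq ?_
  change I (K (D.map T.toPraeDilator I.symm.toOrderEmbedding (T.Dmu _ _))) = _
  rw [map_Dmu, otp_eq]
  change I (K (T.Dmu _ (I.symm (I _)))) = I _
  rw [OrderIso.symm_apply_apply, hK]

/-- If the fixed points bound a derivative, then the derivative enumerates them. -/
theorem UpperDerivative.otp_eq_fixedPoint (A : T.UpperDerivative)
    (hS : A.S.toPraeDilator.IsDilator)
    (J : A.S.toPraeDilator.D Ordinal.{u} ↪o Ordinal.{u})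
    (hJ : ∀ α, J (A.S.Dmu _ α) = fixedPoint hT α) (α : Ordinal.{u}) :
    A.S.toPraeDilator.otp hS α = fixedPoint hT α := by
  apply le_antisymm
  · rw [otp_eq, ← hJ]
    exact enumIso_le hS J _
  -- Here `g β` is the index of the fixed point `otp(D^S_β)`; it is strictly increasing in `β`,
  -- hence at least `β`.
  · choose g hg using fun β => exists_fixedPoint_eq hT (A.otp_otp hT hS β)
    have hgm : StrictMono g := fun β γ h => by
      rw [← (fixedPoint_strictMono hT).lt_iff_lt, hg, hg]
      exact (isNormal_otp hS).strictMono h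
    rw [← hg]
    exact (fixedPoint_strictMono hT).monotone hgm.le_apply

theorem isNormal_otpCountable :
    Order.IsNormal (T.toPraeDilator.otpCountable.{u} hT) := by
  refine Order.isNormal_iff.2 ⟨fun α β h => (isNormal_otp hT).strictMono h, fun α hα β h => ?_⟩
  -- The countable ordinals form a lower set, so limits among them are limits among all ordinals.
  have hα' : Order.IsSuccLimit (α : Ordinal.{u}) := hα.subtypeVal (isLowerSet_Iio _)
  refine ((isNormal_otp hT).le_iff_forall_le hα').2 fun γ hγ => ?_
  exact h ⟨γ, hγ.trans α.2⟩ hγ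

end NormalPraeDilator

theorem mainTheorem6 (T : NormalPraeDilator) (hT : T.toPraeDilator.IsDilator)
    (A : T.UpperDerivative) (hA : A.IsDerivative) :
    ∃ hS : A.S.toPraeDilator.IsDilator,
      (Order.IsNormal (T.toPraeDilator.otpCountable.{u} hT) ∧
        IsOrdinalDerivative (T.toPraeDilator.otpCountable.{u} hT)
          (A.S.toPraeDilator.otpCountable.{u} hS)) ∧
      (Order.IsNormal (T.toPraeDilator.otp.{u} hT) ∧
        IsOrdinalDerivative (T.toPraeDilator.otp.{u} hT) (A.S.toPraeDilator.otp.{u} hS)) := by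
  obtain ⟨ν, -, -⟩ := hA (NormalPraeDilator.fixedPointUpperDerivative.{u} hT)
  obtain ⟨J, hJ⟩ := NormalPraeDilator.exists_embedding_of_hom ν
  have hS := NormalPraeDilator.isDilator_of_embedding J
  have hfix := A.otp_otp hT hS
  have hex : ∀ α : Ordinal.{u}, T.toPraeDilator.otp hT α = α →
      ∃ β, A.S.toPraeDilator.otp hS β = α := fun α h => by
    obtain ⟨β, rfl⟩ := NormalPraeDilator.exists_fixedPoint_eq hT h
    exact ⟨β, A.otp_eq_fixedPoint hT hS J hJ β⟩
  refine ⟨hS, ⟨NormalPraeDilator.isNormal_otpCountable hT,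
    NormalPraeDilator.isNormal_otpCountable hS, ?_⟩,
    NormalPraeDilator.isNormal_otp hT, NormalPraeDilator.isNormal_otp hS, ?_⟩
  · ext α
    constructor
    · rintro ⟨β, rfl⟩
      exact Subtype.ext (hfix β)
    · intro h
      obtain ⟨β, hβ⟩ := hex α (congrArg Subtype.val h)
      -- The index of a countable fixed point is at most that fixed point, hence countable.
      have hle : β ≤ α := (NormalPraeDilator.isNormal_otp hS).strictMono.le_apply.trans_eq hβ
      exact ⟨⟨β, hle.trans_lt α.2⟩, Subtype.ext hβ⟩
  · ext α
    constructor
    · rintro ⟨β, rfl⟩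
      exact hfix β
    · exact hex α
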